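/- Let $\mathrm{VAR}$ be a countably infinite set of variables. The formulas of propositional dependence logic ($\mathcal{PDL}$) are given by $$\varphi ::= \top \mid \bot \mid x \mid \lnot x \mid \varphi\lor\varphi \mid \varphi\land\varphi \mid \mathrm{dep}(X;Y) \mid \lnot\,\mathrm{dep}(X;Y),$$ where $x\in\mathrm{VAR}$ and $X,Y\subset\mathrm{VAR}$ are finite. A team $T$ is a set of assignments $t\colon\mathrm{VAR}\to\{0,1\}$, and satisfaction is defined as follows: $T\models\top$ always; $T\models\bot$ never; $T\models x$ (resp. $T\models\lnot x$) iff $t(x)=1$ (resp. $t(x)=0$) for all $t\in T$; $T\models\varphi\land\psi$ iff $T\models\varphi$ and $T\models\psi$; $T\models\varphi\lor\psi$ iff there are $T_1,T_2$ with $T_1\cup T_2=T$, $T_1\models\varphi$ and $T_2\models\psi$; $T\models\mathrm{dep}(X;Y)$ iff any two $t,t'\in T$ that agree on $X$ agree on $Y$; and $T\models\lnot\,\mathrm{dep}(X;Y)$ iff $T=\emptyset$. The model checking problem is: given a $\mathcal{PDL}$-formula $\Phi$ and a finite team $T$ of assignments to the variables that occur in $\Phi$ (listed without repetition, each assignment written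 out as the list of these variables with their values), decide whether $T\models\Phi$. The parameter is the team size $k=|T|$. Let $|\Phi|$ be the number of symbols of $\Phi$ as a string over a finite alphabet (variables are named in binary), and let $|x|$ be the length of the string $x$ that encodes the whole instance $(T,\Phi)$. Algorithms are deterministic multi-tape Turing machines. Theorem. Model checking for $\mathcal{PDL}$ parameterised by the team size is fixed-parameter tractable: it is decided by an algorithm in time $f(k)\cdot p(|x|)$ for some computable function $f\colon\mathbb N\to\mathbb N$ and some polynomial $p$. More precisely, there are a polynomial $q$ and an algorithm that decides the problem in time $O\bigl(2^{2k}\cdot q(|\Phi|)\bigr)$. -/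

import Mathlib

/-! ### Parameterised problems and fixed-parameter tractability -/

/-- A parameterised decision problem: instances, written as strings over a finite alphabet
(different instances have different strings), the yes-instances, and the parameter. -/
structure ParamProblem where
  Instance : Type
  Symbol : Type
  finite_symbol : Finite Symbol
  encode : Instance → List Symbol
  encode_injective : Function.Injective encode
  Yes : Instance → Prop
  param : Instance → ℕ

namespace ParamProblem

open Classical in
/-- The deterministic multi-stack Turing machine `M`, started on the string of any instance `I`,
halts after at most `t I` steps, with the answer `true` or `false` (whichever is correct for `I`)
as its output. All stack alphabets of `M` are finite. -/
def DecidedBy (P : ParamProblem) (M : Turing.TM2ComputableAux P.Symbol Bool)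
    (t : P.Instance → ℕ) : Prop :=
  (∀ k, Finite (M.tm.Γ k)) ∧
  ∀ I : P.Instance, Nonempty (Turing.TM2OutputsInTime M.tm
    ((P.encode I).map M.inputAlphabet.symm)
    (some ((Computability.encodeBool (decide (P.Yes I))).map M.outputAlphabet.symm))
    (t I))

/-- Fixed-parameter tractability: decidable in time `f(k) · p(|x|)`, where `f` is computable, `p` is
a polynomial, `|x|` is the length of the input string and `k` is the parameter. -/
def FPT (P : ParamProblem) : Prop :=
  ∃ f : ℕ → ℕ, Computable f ∧ ∃ (p : Polynomial ℕ) (M : Turing.TM2ComputableAux P.Symbol Bool),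
    P.DecidedBy M (fun I => f (P.param I) * p.eval (P.encode I).length)

end ParamProblem

/-! ### Propositional dependence logic -/

namespace PDL

/-- Formulas of propositional dependence logic; the variables are the natural numbers. -/
inductive Formula : Type
  | verum : Formula
  | falsum : Formula
  | var (x : ℕ) : Formula
  | negVar (x : ℕ) : Formula
  | or (φ ψ : Formula) : Formula
  | and (φ ψ : Formula) : Formula
  | dep (X Y : Finset ℕ) : Formula
  | negDep (X Y : Finset ℕ) : Formula

/-- Team semantics (with lax splitting); a team is a set of assignments `ℕ → Bool`. -/
def Sat : Set (ℕ → Bool) → Formula → Prop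
  | _, .verum => True
  | _, .falsum => False
  | T, .var x => ∀ t ∈ T, t x = true
  | T, .negVar x => ∀ t ∈ T, t x = false
  | T, .or φ ψ => ∃ T₁ T₂ : Set (ℕ → Bool), T₁ ∪ T₂ = T ∧ Sat T₁ φ ∧ Sat T₂ ψ
  | T, .and φ ψ => Sat T φ ∧ Sat T ψ
  | T, .dep X Y => ∀ t ∈ T, ∀ t' ∈ T, (∀ p ∈ X, t p = t' p) → ∀ q ∈ Y, t q = t' q
  | T, .negDep _ _ => T = ∅

/-- The variables that occur in a formula. -/
def Formula.vars : Formula → Finset ℕ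
  | .verum => ∅
  | .falsum => ∅
  | .var x => {x}
  | .negVar x => {x}
  | .or φ ψ => φ.vars ∪ ψ.vars
  | .and φ ψ => φ.vars ∪ ψ.vars
  | .dep X Y => X ∪ Y
  | .negDep X Y => X ∪ Y

/-! ### Encoding of formulas and teams as strings -/

/-- The input alphabet: one symbol for each formula constructor, the bits, a symbol `sep` that ends
the name of a variable, and a symbol `close` that ends a list of variables or an assignment. -/
inductive Sym : Type
  | verum | falsum | pos | neg | or | and | dep | negDep | sep | close
  | bit (b : Bool)
  deriving DecidableEq, Fintype

/-- A variable is written in binary. -/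
def encodeVar (x : ℕ) : List Sym :=
  (Computability.encodeNat x).map Sym.bit ++ [Sym.sep]

/-- A finite set of variables is written as the list of its elements in increasing order. -/
def encodeVars (X : Finset ℕ) : List Sym :=
  (X.sort (· ≤ ·)).flatMap encodeVar ++ [Sym.close]

/-- A formula is written in prefix notation. -/
def Formula.encode : Formula → List Sym
  | .verum => [Sym.verum]
  | .falsum => [Sym.falsum]
  | .var x => Sym.pos :: encodeVar x
  | .negVar x => Sym.neg :: encodeVar x
  | .or φ ψ => Sym.or :: (φ.encode ++ ψ.encode)
  | .and φ ψ => Sym.and :: (φ.encode ++ ψ.encode)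
  | .dep X Y => Sym.dep :: (encodeVars X ++ encodeVars Y)
  | .negDep X Y => Sym.negDep :: (encodeVars X ++ encodeVars Y)

/-- The size `|Φ|` of a formula: the number of symbols in its string. -/
def Formula.size (φ : Formula) : ℕ := φ.encode.length

/-- An assignment to the variables in `V` is written as the list of these variables, each followed
by its value. -/
def encodeAssignment (V : Finset ℕ) (t : ℕ → Bool) : List Sym :=
  (V.sort (· ≤ ·)).flatMap (fun x => encodeVar x ++ [Sym.bit (t x)]) ++ [Sym.close]

/-- An instance of model checking: a formula `Φ` and a finite team of assignments to the variables
of `Φ`. The team is listed without repetitions, in an arbitrary order. An assignment to the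
variables of `Φ` is represented by the function on all variables that is `false` elsewhere. -/
structure MCInstance where
  formula : Formula
  rows : List (ℕ → Bool)
  rows_nodup : rows.Nodup
  rows_supported : ∀ t ∈ rows, ∀ x ∉ formula.vars, t x = false

/-- The team of an instance. -/
def MCInstance.team (I : MCInstance) : Set (ℕ → Bool) := {t | t ∈ I.rows}

/-- The team size of an instance: the number of assignments in its team. -/
noncomputable def MCInstance.teamSize (I : MCInstance) : ℕ := I.team.ncard

/-- The input string: the formula, followed by the assignments of the team. -/
def MCInstance.encode (I : MCInstance) : List Sym :=
  I.formula.encode ++ I.rows.flatMap (encodeAssignment I.formula.vars)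

/-! ### Different instances have different strings -/

theorem encodeVar_append_inj {x y : ℕ} {s s' : List Sym}
    (h : encodeVar x ++ s = encodeVar y ++ s') : x = y ∧ s = s' := by
  have key : ∀ (l l' : List Bool), l.map Sym.bit ++ [Sym.sep] ++ s =
      l'.map Sym.bit ++ [Sym.sep] ++ s' → l = l' ∧ s = s' := by
    intro l
    induction l with
    | nil => intro l' h; cases l' <;> simp_all
    | cons a l ih =>
      intro l' h
      cases l' with
      | nil => simp at h
      | cons b l' =>
        simp only [List.map_cons, List.cons_append, List.cons.injEq, Sym.bit.injEq] at h
        obtain ⟨h1, h2⟩ := ih l' h.2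
        exact ⟨by rw [h.1, h1], h2⟩
  obtain ⟨h1, h2⟩ := key _ _ h
  refine ⟨?_, h2⟩
  rw [← Computability.decode_encodeNat x, h1, Computability.decode_encodeNat]

theorem encodeVar_append_ne_close (x : ℕ) (s s' : List Sym) :
    encodeVar x ++ s ≠ Sym.close :: s' := by
  unfold encodeVar
  cases Computability.encodeNat x <;> simp

theorem encodeVars_append_inj {X Y : Finset ℕ} {s s' : List Sym}
    (h : encodeVars X ++ s = encodeVars Y ++ s') : X = Y ∧ s = s' := by
  have key : ∀ (l l' : List ℕ), l.flatMap encodeVar ++ Sym.close :: s =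
      l'.flatMap encodeVar ++ Sym.close :: s' → l = l' ∧ s = s' := by
    intro l
    induction l with
    | nil =>
      intro l' h
      cases l' with
      | nil => simpa using h
      | cons b l' =>
        simp only [List.flatMap_nil, List.nil_append, List.flatMap_cons, List.append_assoc] at h
        exact absurd h.symm (encodeVar_append_ne_close _ _ _)
    | cons a l ih =>
      intro l' h
      cases l' with
      | nil =>
        simp only [List.flatMap_nil, List.nil_append, List.flatMap_cons, List.append_assoc] at h
        exact absurd h (encodeVar_append_ne_close _ _ _)
      | cons b l' =>
        simp only [List.flatMap_cons, List.append_assoc] at h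
        obtain ⟨h1, h2⟩ := encodeVar_append_inj h
        obtain ⟨h3, h4⟩ := ih l' h2
        exact ⟨by rw [h1, h3], h4⟩
  obtain ⟨h1, h2⟩ := key _ _ (by simpa [encodeVars] using h)
  refine ⟨?_, h2⟩
  rw [← Finset.sort_toFinset X (· ≤ ·), h1, Finset.sort_toFinset]

theorem Formula.encode_append_inj (φ : Formula) : ∀ (ψ : Formula) (s s' : List Sym),
    φ.encode ++ s = ψ.encode ++ s' → φ = ψ ∧ s = s' := by
  induction φ with
  | verum => intro ψ s s' h; cases ψ <;> simp_all [Formula.encode]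
  | falsum => intro ψ s s' h; cases ψ <;> simp_all [Formula.encode]
  | var x =>
    intro ψ s s' h
    cases ψ <;> simp only [Formula.encode, List.cons_append, List.cons.injEq, reduceCtorEq,
      false_and, true_and] at h
    obtain ⟨rfl, rfl⟩ := encodeVar_append_inj h
    exact ⟨rfl, rfl⟩
  | negVar x =>
    intro ψ s s' h
    cases ψ <;> simp only [Formula.encode, List.cons_append, List.cons.injEq, reduceCtorEq,
      false_and, true_and] at h
    obtain ⟨rfl, rfl⟩ := encodeVar_append_inj h
    exact ⟨rfl, rfl⟩
  | or φ₁ φ₂ ih₁ ih₂ =>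
    intro ψ s s' h
    cases ψ <;> simp only [Formula.encode, List.cons_append, List.cons.injEq, reduceCtorEq,
      false_and, true_and, List.append_assoc] at h
    obtain ⟨rfl, h2⟩ := ih₁ _ _ _ h
    obtain ⟨rfl, h3⟩ := ih₂ _ _ _ h2
    exact ⟨rfl, h3⟩
  | and φ₁ φ₂ ih₁ ih₂ =>
    intro ψ s s' h
    cases ψ <;> simp only [Formula.encode, List.cons_append, List.cons.injEq, reduceCtorEq,
      false_and, true_and, List.append_assoc] at h
    obtain ⟨rfl, h2⟩ := ih₁ _ _ _ h
    obtain ⟨rfl, h3⟩ := ih₂ _ _ _ h2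
    exact ⟨rfl, h3⟩
  | dep X Y =>
    intro ψ s s' h
    cases ψ <;> simp only [Formula.encode, List.cons_append, List.cons.injEq, reduceCtorEq,
      false_and, true_and, List.append_assoc] at h
    obtain ⟨rfl, h2⟩ := encodeVars_append_inj h
    obtain ⟨rfl, h3⟩ := encodeVars_append_inj h2
    exact ⟨rfl, h3⟩
  | negDep X Y =>
    intro ψ s s' h
    cases ψ <;> simp only [Formula.encode, List.cons_append, List.cons.injEq, reduceCtorEq,
      false_and, true_and, List.append_assoc] at h
    obtain ⟨rfl, h2⟩ := encodeVars_append_inj h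
    obtain ⟨rfl, h3⟩ := encodeVars_append_inj h2
    exact ⟨rfl, h3⟩

theorem encodeAssignment_append_inj {V : Finset ℕ} {t t' : ℕ → Bool} {s s' : List Sym}
    (h : encodeAssignment V t ++ s = encodeAssignment V t' ++ s') :
    (∀ x ∈ V, t x = t' x) ∧ s = s' := by
  have key : ∀ l : List ℕ,
      l.flatMap (fun x => encodeVar x ++ [Sym.bit (t x)]) ++ Sym.close :: s =
      l.flatMap (fun x => encodeVar x ++ [Sym.bit (t' x)]) ++ Sym.close :: s' →
      (∀ x ∈ l, t x = t' x) ∧ s = s' := by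
    intro l
    induction l with
    | nil => intro h; simpa using h
    | cons a l ih =>
      intro h
      simp only [List.flatMap_cons, List.append_assoc, List.append_cancel_left_eq,
        List.cons_append, List.nil_append, List.cons.injEq, Sym.bit.injEq] at h
      obtain ⟨h1, h2⟩ := ih h.2
      exact ⟨by simpa using ⟨h.1, h1⟩, h2⟩
  obtain ⟨h1, h2⟩ := key (V.sort (· ≤ ·)) (by simpa [encodeAssignment] using h)
  exact ⟨fun x hx => h1 x ((Finset.mem_sort _).2 hx), h2⟩

theorem encodeAssignment_ne_nil (V : Finset ℕ) (t : ℕ → Bool) (s : List Sym) :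
    encodeAssignment V t ++ s ≠ [] := by
  simp [encodeAssignment]

theorem MCInstance.encode_injective : Function.Injective MCInstance.encode := by
  rintro ⟨φ, l, hl, hs⟩ ⟨φ', l', hl', hs'⟩ h
  obtain ⟨h1, h2⟩ := Formula.encode_append_inj _ _ _ _ h
  dsimp only at h1 h2
  subst h1
  have key : ∀ l l' : List (ℕ → Bool),
      (∀ t ∈ l, ∀ x ∉ φ.vars, t x = false) → (∀ t ∈ l', ∀ x ∉ φ.vars, t x = false) →
      l.flatMap (encodeAssignment φ.vars) = l'.flatMap (encodeAssignment φ.vars) → l = l' := by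
    intro l
    induction l with
    | nil =>
      intro l' _ _ h
      cases l' with
      | nil => rfl
      | cons b l' => exact absurd h.symm (encodeAssignment_ne_nil _ _ _)
    | cons a l ih =>
      intro l' hs hs' h
      cases l' with
      | nil => exact absurd h (encodeAssignment_ne_nil _ _ _)
      | cons b l' =>
        obtain ⟨h1, h2⟩ := encodeAssignment_append_inj h
        have hab : a = b := by
          funext x
          by_cases hx : x ∈ φ.vars
          · exact h1 x hx
          · rw [hs a (by simp) x hx, hs' b (by simp) x hx]
        rw [hab, ih l' (fun t ht => hs t (by simp [ht])) (fun t ht => hs' t (by simp [ht])) h2]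
  have hll := key l l' hs hs' h2
  subst hll
  rfl

/-- Model checking for propositional dependence logic, parameterised by the team size. -/
noncomputable def mcTeamSize : ParamProblem where
  Instance := MCInstance
  Symbol := Sym
  finite_symbol := inferInstance
  encode := MCInstance.encode
  encode_injective := MCInstance.encode_injective
  Yes I := Sat I.team I.formula
  param := MCInstance.teamSize

end PDL

/-! For every subformula, compute the table of all subteams of the given team that satisfy it: `2 ^
k` bits, indexed by the 0/1 vectors over the rows in lexicographic order. The answer is the entry of
the full team. Literals, constants and conjunctions are immediate. A dependence atom is built
variable by variable: start from the table that is true everywhere, conjoin "`y` is constant" for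
each `y ∈ Y`, then for each `x ∈ X` replace a property `Q` by "`Q` holds on both halves `x = 1` and
`x = 0`". The result says that `Y` is constant on each class of assignments agreeing on `X`
(`reach_dependence`).

For a disjunction, satisfaction is downward closed (`Sat.mono`), so overlapping parts of a split can
be made disjoint (`exists_split_iff`). Disjoint splits of subteams are words over three digits
(absent, left, right), so a table with `3 ^ k` entries suffices instead of one for all pairs of
subteams.

Stacks allow no random access, so tables are processed by passes. A pass combines the adjacent
entries whose indices differ only in the last digit and distributes the results over stacks
according to a new digit; concatenating these stacks moves that digit to the front
(`reach_next_pass`). After `k` passes every digit has been treated once, with the bit of its own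
row, and the row order is restored (`reach_passes`). A pass may read and write different numbers of
digits; this builds a table from one entry, expands it to three digits, and collapses it again. The
lemmas `passes_lit`, `passes_cst`, `passes_spl`, `passes_conv` and `passes_merge` give the net
effects.

An operation costs `O(k)` passes over at most `3 ^ k` entries, and `k * 3 ^ k = O(4 ^ k)`, plus
scans of the rows, whose length is linear in `k` times the formula size. Charging at most one
operation to each symbol of the formula gives `O(2 ^ (2 * k))` times a cubic polynomial in the
formula size. -/

/-! ### Multi-stack machines given by a transition function -/

namespace MultiStack

open Turing

/-- An action on one stack: possibly remove the top, then possibly push a symbol. -/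
structure Act (α : Type) where
  pop : Bool := false
  push : Option α := none

/-- The stack after an action. -/
def Act.apply {α : Type} (a : Act α) (l : List α) : List α :=
  a.push.toList ++ (if a.pop then l.tail else l)

variable {K : Type} {Γ : K → Type} {Λ : Type}

/-- A transition function: from the label and the top symbols of all stacks to the next label
(`none` to halt) and an action on each stack. -/
abbrev Trans (Γ : K → Type) (Λ : Type) : Type :=
  Λ → (∀ k, Option (Γ k)) → Option Λ × (∀ k, Act (Γ k))

/-- Perform the actions on the listed stacks, then go to the next label. -/
def writeStmt [∀ k, Inhabited (Γ k)] (δ : Trans Γ Λ) (l : Λ) :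
    List K → TM2.Stmt Γ Λ (∀ k, Option (Γ k))
  | [] => .branch (fun v => (δ l v).1.isSome) (.goto fun v => (δ l v).1.getD l)
      (.load (fun _ _ => none) .halt)
  | k :: ks =>
    let q := TM2.Stmt.branch (fun v => ((δ l v).2 k).push.isSome)
      (.push k (fun v => ((δ l v).2 k).push.getD default) (writeStmt δ l ks)) (writeStmt δ l ks)
    .branch (fun v => ((δ l v).2 k).pop) (.pop k (fun v _ => v) q) q

/-- Read the tops of the listed stacks. -/
def readStmt [DecidableEq K] (q : TM2.Stmt Γ Λ (∀ k, Option (Γ k))) :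
    List K → TM2.Stmt Γ Λ (∀ k, Option (Γ k))
  | [] => q
  | k :: ks => .peek k (fun v a => Function.update v k a) (readStmt q ks)

/-- All decisions depend on `v`, which stays fixed while the stacks change, so the actions do not
influence each other; distinctness of `ks` makes each stack be acted on only once. -/
theorem stepAux_writeStmt [DecidableEq K] [∀ k, Inhabited (Γ k)] (δ : Trans Γ Λ) (l : Λ)
    (v : ∀ k, Option (Γ k)) (ks : List K) (hks : ks.Nodup) (S : ∀ k, List (Γ k)) :
    TM2.stepAux (writeStmt δ l ks) v S =
      ⟨(δ l v).1, if (δ l v).1.isSome then v else fun _ => none,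
        fun k => if k ∈ ks then ((δ l v).2 k).apply (S k) else S k⟩ := by
  induction ks generalizing S with
  | nil =>
    rcases h : (δ l v).1 with _ | l' <;> simp [writeStmt, h]
  | cons k ks ih =>
    have hk : k ∉ ks := (List.nodup_cons.1 hks).1
    have ih := ih (List.nodup_cons.1 hks).2
    have key : ∀ (S' : ∀ k, List (Γ k)), S' k = ((δ l v).2 k).apply (S k) →
        (∀ j, j ≠ k → S' j = S j) →
        (fun j => if j ∈ ks then ((δ l v).2 j).apply (S' j) else S' j) =
          fun j => if j ∈ k :: ks then ((δ l v).2 j).apply (S j) else S j := by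
      intro S' h1 h2
      funext j
      by_cases hj : j = k
      · subst hj; simp [hk, h1]
      · simp [hj, h2 j hj]
    simp only [writeStmt, TM2.stepAux]
    rcases hp : ((δ l v).2 k).pop <;> rcases hq : ((δ l v).2 k).push with _ | a <;>
      simp only [cond_true, cond_false, Option.isSome, ih, Option.getD] <;> congr 1 <;>
      apply key <;> simp +contextual [Act.apply, hp, hq]

theorem stepAux_readStmt [DecidableEq K] (q : TM2.Stmt Γ Λ (∀ k, Option (Γ k))) (ks : List K)
    (v : ∀ k, Option (Γ k)) (S : ∀ k, List (Γ k)) :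
    TM2.stepAux (readStmt q ks) v S =
      TM2.stepAux q (fun k => if k ∈ ks then (S k).head? else v k) S := by
  induction ks generalizing v with
  | nil => simp [readStmt]
  | cons k ks ih =>
    simp only [readStmt, TM2.stepAux, ih]
    congr 1
    funext j
    by_cases hj : j ∈ ks
    · simp [hj]
    · by_cases hjk : j = k
      · subst hjk; simp
      · simp [hj, hjk]

/-- The machine with the given transition function. -/
noncomputable def toFinTM2 [DecidableEq K] [Fintype K] [Finite Λ] [∀ k, Inhabited (Γ k)] [∀ k, Finite (Γ k)]
    (δ : Trans Γ Λ) (k₀ k₁ : K) (main : Λ) : FinTM2 :=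
  { K := K
    k₀ := k₀
    k₁ := k₁
    Γ := Γ
    Λ := Λ
    main := main
    ΛFin := Fintype.ofFinite Λ
    σ := ∀ k, Option (Γ k)
    initialState := fun _ => none
    σFin := Fintype.ofFinite _
    Γk₀Fin := Fintype.ofFinite _
    m := fun l => readStmt (writeStmt δ l Finset.univ.toList) Finset.univ.toList }

/-- The machine with transition function `δ` gets in at most `n` steps from one pair of a label and
stack contents to another. -/
inductive Run (δ : Trans Γ Λ) : ℕ → Option Λ → (∀ k, List (Γ k)) → Option Λ →
    (∀ k, List (Γ k)) → Prop
  | refl (n : ℕ) (l : Option Λ) (S : ∀ k, List (Γ k)) : Run δ n l S l S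
  | step {n : ℕ} {l : Λ} {S : ∀ k, List (Γ k)} {l' : Option Λ} {S' : ∀ k, List (Γ k)}
      (h : Run δ n (δ l fun k => (S k).head?).1
        (fun k => ((δ l fun k => (S k).head?).2 k).apply (S k)) l' S') :
      Run δ (n + 1) (some l) S l' S'

theorem Run.trans {δ : Trans Γ Λ} {n m : ℕ} {l l' l'' : Option Λ} {S S' S'' : ∀ k, List (Γ k)}
    (h : Run δ n l S l' S') (h' : Run δ m l' S' l'' S'') : Run δ (n + m) l S l'' S'' := by
  induction h with
  | refl n l S =>
    induction h' with
    | refl => exact .refl _ _ _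
    | step _ ih => exact .step ih
  | step _ ih => rw [Nat.add_right_comm]; exact .step (ih h')

/-- Each statement overwrites the local store with the current tops before using it, so the store
left by earlier steps is irrelevant. Only a halting configuration must carry the initial store; the
write statement resets it, and `hv` records this. -/
theorem Run.evals [DecidableEq K] [Fintype K] [Finite Λ] [∀ k, Inhabited (Γ k)] [∀ k, Finite (Γ k)]
    {δ : Trans Γ Λ} {k₀ k₁ : K} {main : Λ} {n : ℕ} {l : Option Λ} {S S' : ∀ k, List (Γ k)}
    {l' : Option Λ} (h : Run δ n l S l' S') (hl' : l' = none) (v : ∀ k, Option (Γ k))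
    (hv : l = none → v = fun _ => none) :
    ∃ m ≤ n, (flip bind (toFinTM2 δ k₀ k₁ main).step)^[m]
      (some (⟨l, v, S⟩ : TM2.Cfg Γ Λ (∀ k, Option (Γ k)))) =
        some (⟨none, fun _ => none, S'⟩ : TM2.Cfg Γ Λ (∀ k, Option (Γ k))) := by
  induction h generalizing v with
  | refl n l S =>
    subst hl'
    exact ⟨0, Nat.zero_le _, by rw [hv rfl]; rfl⟩
  | @step n l S l' S' h ih =>
    obtain ⟨m, hm, e⟩ := ih hl' _ (fun h0 => by rw [h0]; rfl :
      _ → (if (δ l fun k => (S k).head?).1.isSome then (fun k => (S k).head?) else fun _ => none)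
        = fun _ => none)
    refine ⟨m + 1, by omega, ?_⟩
    rw [Function.iterate_succ_apply, ← e]
    congr 1
    change some (TM2.stepAux (readStmt (writeStmt δ l Finset.univ.toList) Finset.univ.toList) v S)
      = _
    rw [stepAux_readStmt, stepAux_writeStmt _ _ _ _ (Finset.nodup_toList _)]
    simp only [Finset.mem_toList, Finset.mem_univ, if_true]
    rfl

end MultiStack

/-! ### The machine for model checking -/

namespace PDL

open MultiStack

/-- The stacks. -/
inductive Stk : Type
  | inp | out | frm | cnt | rev | nam | aux | col | tab | wrk | oa | ob | oc
  deriving DecidableEq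

instance : Fintype Stk where
  elems := {.inp, .out, .frm, .cnt, .rev, .nam, .aux, .col, .tab, .wrk, .oa, .ob, .oc}
  complete x := by cases x <;> simp

/-- The stack alphabets. -/
def Alph : Stk → Type
  | .inp | .frm | .rev => Sym
  | .out | .nam | .aux | .col => Bool
  | .cnt => Unit
  | .tab => Option Bool
  | .wrk | .oa | .ob | .oc => Bool × Bool

instance inhabited_alph (k : Stk) : Inhabited (Alph k) := by
  cases k <;> unfold Alph <;> first | exact ⟨Sym.verum⟩ | infer_instance

instance finite_alph (k : Stk) : Finite (Alph k) := by
  cases k <;> unfold Alph <;> infer_instance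

/-- The contents of all stacks. -/
structure Mem where
  inp : List Sym := []
  out : List Bool := []
  frm : List Sym := []
  cnt : List Unit := []
  rev : List Sym := []
  nam : List Bool := []
  aux : List Bool := []
  col : List Bool := []
  tab : List (Option Bool) := []
  wrk : List (Bool × Bool) := []
  oa : List (Bool × Bool) := []
  ob : List (Bool × Bool) := []
  oc : List (Bool × Bool) := []

/-- The content of one stack. -/
def Mem.get (s : Mem) : ∀ k, List (Alph k)
  | .inp => s.inp
  | .out => s.out
  | .frm => s.frm
  | .cnt => s.cnt
  | .rev => s.rev
  | .nam => s.nam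
  | .aux => s.aux
  | .col => s.col
  | .tab => s.tab
  | .wrk => s.wrk
  | .oa => s.oa
  | .ob => s.ob
  | .oc => s.oc

/-- An action on each stack. -/
structure Acts where
  inp : Act Sym := {}
  out : Act Bool := {}
  frm : Act Sym := {}
  cnt : Act Unit := {}
  rev : Act Sym := {}
  nam : Act Bool := {}
  aux : Act Bool := {}
  col : Act Bool := {}
  tab : Act (Option Bool) := {}
  wrk : Act (Bool × Bool) := {}
  oa : Act (Bool × Bool) := {}
  ob : Act (Bool × Bool) := {}
  oc : Act (Bool × Bool) := {}

/-- The action on one stack. -/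
def Acts.get (s : Acts) : ∀ k, Act (Alph k)
  | .inp => s.inp
  | .out => s.out
  | .frm => s.frm
  | .cnt => s.cnt
  | .rev => s.rev
  | .nam => s.nam
  | .aux => s.aux
  | .col => s.col
  | .tab => s.tab
  | .wrk => s.wrk
  | .oa => s.oa
  | .ob => s.ob
  | .oc => s.oc

/-- The contents of the stacks after an action on each of them. -/
def Mem.apply (s : Mem) (a : Acts) : Mem where
  inp := a.inp.apply s.inp
  out := a.out.apply s.out
  frm := a.frm.apply s.frm
  cnt := a.cnt.apply s.cnt
  rev := a.rev.apply s.rev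
  nam := a.nam.apply s.nam
  aux := a.aux.apply s.aux
  col := a.col.apply s.col
  tab := a.tab.apply s.tab
  wrk := a.wrk.apply s.wrk
  oa := a.oa.apply s.oa
  ob := a.ob.apply s.ob
  oc := a.oc.apply s.oc

/-- The top symbols of the stacks that are read. -/
structure Tops where
  inp : Option Sym
  frm : Option Sym
  cnt : Option Unit
  rev : Option Sym
  nam : Option Bool
  aux : Option Bool
  col : Option Bool
  tab : Option (Option Bool)
  wrk : Option (Bool × Bool)
  oa : Option (Bool × Bool)
  ob : Option (Bool × Bool)
  oc : Option (Bool × Bool)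

/-- The top symbols of the stacks that are read, from those of all stacks. -/
def Tops.of (t : ∀ k, Option (Alph k)) : Tops where
  inp := t .inp
  frm := t .frm
  cnt := t .cnt
  rev := t .rev
  nam := t .nam
  aux := t .aux
  col := t .col
  tab := t .tab
  wrk := t .wrk
  oa := t .oa
  ob := t .ob
  oc := t .oc

/-- The top symbols of the stacks that are read. -/
def Mem.tops (s : Mem) : Tops where
  inp := s.inp.head?
  frm := s.frm.head?
  cnt := s.cnt.head?
  rev := s.rev.head?
  nam := s.nam.head?
  aux := s.aux.head?
  col := s.col.head?
  tab := s.tab.head?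
  wrk := s.wrk.head?
  oa := s.oa.head?
  ob := s.ob.head?
  oc := s.oc.head?

/-- How an entry of a table is obtained from a pair of bits. -/
inductive Final : Type
  | top | bot | fst | snd | conj | disj
  deriving DecidableEq

instance : Fintype Final where
  elems := {.top, .bot, .fst, .snd, .conj, .disj}
  complete x := by cases x <;> simp

/-- The value of a pair of bits. -/
def Final.eval : Final → Bool × Bool → Bool
  | .top, _ => true
  | .bot, _ => false
  | .fst, x => x.1
  | .snd, x => x.2
  | .conj, x => x.1 && x.2
  | .disj, x => x.1 || x.2

/-- The operations on tables. -/
inductive Op : Type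
  | lit (h : Final) | cst (h : Final) | spl | conj | conv | merge
  deriving Fintype

/-- How the entries of the resulting table are obtained. -/
def Op.final : Op → Final
  | .lit h => h
  | .cst h => h
  | .spl => .conj
  | .conj => .conj
  | .conv => .conj
  | .merge => .fst

/-- The parser is outside of lists of variables, in the second, or in the first list of a
(negated) dependence atom. -/
inductive Mode : Type
  | expr | snd | fst
  deriving DecidableEq

instance : Fintype Mode where
  elems := {.expr, .snd, .fst}
  complete x := by cases x <;> simp

/-- The digits in the index of an entry of a table. -/
inductive Digit : Type
  | zero | one | two
  deriving DecidableEq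

/-- The digits that an operation reads. -/
def Op.din : Op → List Digit
  | .lit _ => [.zero]
  | .merge => [.zero, .one, .two]
  | _ => [.zero, .one]

/-- The digits that an operation writes. -/
def Op.dout : Op → List Digit
  | .conv => [.zero, .one, .two]
  | _ => [.zero, .one]

/-- The entry with digit `a` that an operation writes, if it has read the entries `F`. -/
def Op.entry (o : Op) (c : Bool) (a : Digit) (F : Digit → Bool × Bool) : Bool × Bool :=
  match o, a with
  | .lit _, .zero => F .zero
  -- A row outside the subteam imposes no condition. A row inside must have bit `true` for the first
  -- component and `false` for the second.
  | .lit _, _ => ((F .zero).1 && c, (F .zero).2 && !c)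
  | .cst _, .zero => F .zero
  | .cst _, _ => ((F .one).1 && c, (F .one).2 && !c)
  | .spl, .zero => F .zero
  -- A row that belongs to the other half is dropped by reading the entry at digit zero.
  | .spl, _ => if c then ((F .one).1, (F .zero).2) else ((F .zero).1, (F .one).2)
  | .merge, .zero => F .zero
  | .merge, _ => ((F .one).1 || (F .two).1, false)
  | .conv, .zero => F .zero
  | .conv, .one => ((F .one).1, (F .zero).2)
  | .conv, .two => ((F .zero).1, (F .one).2)
  -- A conjunction is run with an empty column, hence without passes, and this value plays no role.
  | .conj, _ => F .zero

/-- The entries for the digits, given those for zero, one and two. -/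
def entries (x y z : Bool × Bool) : Digit → Bool × Bool
  | .zero => x
  | .one => y
  | .two => z

set_option synthInstance.maxHeartbeats 400000 in
set_option synthInstance.maxSize 1000 in
/-- The labels of the program. -/
inductive Label : Type
  | start | scan | copyVar | copyVars | copyVars'
  | go (m : Mode)
  | name (m : Mode)
  | look (o : Op) (m : Mode) (found mismatch : Bool)
  | restore (o : Op) (m : Mode) (found mtch : Bool)
  | rewind (o : Op) (m : Mode)
  | clear (o : Op) (m : Mode)
  | load (o : Op) (m : Mode)
  | load' (o : Op) (m : Mode)
  | zip (o : Op) (m : Mode)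
  | gatherC (o : Op) (m : Mode)
  | gatherB (o : Op) (m : Mode)
  | gatherA (o : Op) (m : Mode)
  | next (o : Op) (m : Mode)
  | pass (o : Op) (m : Mode) (c : Bool) (x y : Option (Bool × Bool))
  | fin (o : Op) (m : Mode)
  | save (m : Mode)
  | answer (b : Bool)
  | erase (b : Bool)
  deriving Fintype

/-- Remove the top symbol. -/
abbrev take {α : Type} : Act α := { pop := true }

/-- Add a symbol. -/
abbrev put {α : Type} (x : α) : Act α := { push := some x }

/-- The end of a pass step: write the entries. -/
def emit (o : Op) (m : Mode) (c : Bool) (F : Digit → Bool × Bool) : Option Label × Acts :=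
  (some (.pass o m c none none),
    { wrk := take
      oa := put (o.entry c .zero F)
      ob := put (o.entry c .one F)
      oc := match o with
        | .conv => put (o.entry c .two F)
        | _ => {} })

/-- The program. -/
def trans (l : Label) (t : Tops) : Option Label × Acts :=
  match l with
  | .start => (some .scan, { cnt := put () })
  -- `cnt` holds one mark per subformula still to be read, which finds the end of the prefix
  -- notation: a connective replaces one mark by two, an atom removes one.
  | .scan =>
    match t.cnt with
    | none => (some (.go .expr), {})
    | some _ =>
      match t.inp with
      | none => (none, {})
      | some a =>
        match a with
        | .verum | .falsum => (some .scan, { inp := take, frm := put a, cnt := take })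
        | .pos | .neg => (some .copyVar, { inp := take, frm := put a, cnt := take })
        | .or | .and => (some .scan, { inp := take, frm := put a, cnt := put () })
        | .dep | .negDep => (some .copyVars, { inp := take, frm := put a, cnt := take })
        | _ => (none, {})
  | .copyVar =>
    match t.inp with
    | none => (none, {})
    | some a =>
      match a with
      | .sep => (some .scan, { inp := take, frm := put a })
      | _ => (some .copyVar, { inp := take, frm := put a })
  | .copyVars =>
    match t.inp with
    | none => (none, {})
    | some a =>
      match a with
      | .close => (some .copyVars', { inp := take, frm := put a })
      | _ => (some .copyVars, { inp := take, frm := put a })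
  | .copyVars' =>
    match t.inp with
    | none => (none, {})
    | some a =>
      match a with
      | .close => (some .scan, { inp := take, frm := put a })
      | _ => (some .copyVars', { inp := take, frm := put a })
  -- `frm` holds the formula backwards, so operands come before their connective. A `close` met here
  -- ends the second list of a dependence atom, whose table starts as constantly true.
  | .go .expr =>
    match t.frm with
    | none => (some (.answer false), {})
    | some .verum => (some (.look (.lit .top) .expr false false), { frm := take })
    | some .falsum => (some (.look (.lit .bot) .expr false false), { frm := take })
    | some .pos => (some (.look (.lit .fst) .expr false false), { frm := take })
    | some .neg => (some (.look (.lit .snd) .expr false false), { frm := take })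
    | some .and => (some (.load .conj .expr), { frm := take })
    | some .or => (some (.look .conv .expr false false), { frm := take })
    | some .sep => (some (.name .expr), { frm := take })
    | some .close => (some (.look (.lit .top) .snd false false), { frm := take })
    | some _ => (none, {})
  | .go .snd =>
    match t.frm with
    | some .sep => (some (.name .snd), { frm := take })
    | some .close => (some (.go .fst), { frm := take })
    | _ => (none, {})
  | .go .fst =>
    match t.frm with
    | some .sep => (some (.name .fst), { frm := take })
    | some .dep => (some (.go .expr), { frm := take })
    | some .negDep => (some (.look (.cst .conj) .expr false false), { frm := take })
    | _ => (none, {})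
  | .name m =>
    match t.frm with
    | some (.bit b) => (some (.name m), { frm := take, nam := put b })
    | _ =>
      match m with
      | .expr => (some (.go .expr), {})
      | .snd => (some (.look (.cst .disj) .snd false false), {})
      | .fst => (some (.look .spl .fst false false), {})
  -- `v` is the value found so far in the current row and `mis` flags a mismatch in the current
  -- name. Only name bits are met here; value bits are consumed by `restore`.
  | .look o m v mis =>
    match t.inp with
    | none => (some (.rewind o m), {})
    | some (.bit b) =>
      match t.nam with
      | none => (some (.look o m v true), { inp := take, rev := put (.bit b) })
      | some c => (some (.look o m v (mis || (b != c))),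
          { inp := take, rev := put (.bit b), nam := take, aux := put c })
    | some .sep => (some (.restore o m v (!mis && t.nam.isNone)), { inp := take, rev := put .sep })
    | some a => (some (.look o m false false), { inp := take, rev := put a, col := put v })
  | .restore o m v mt =>
    match t.aux with
    | some c => (some (.restore o m v mt), { aux := take, nam := put c })
    | none =>
      match t.inp with
      | some (.bit b) => (some (.look o m (if mt then b else v) false),
          { inp := take, rev := put (.bit b) })
      | _ => (none, {})
  | .rewind o m =>
    match t.rev with
    | some a => (some (.rewind o m), { rev := take, inp := put a })
    | none => (some (.clear o m), {})
  | .clear o m =>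
    match t.nam with
    | some _ => (some (.clear o m), { nam := take })
    | none => (some (.load o m), {})
  | .load o m =>
    match o with
    | .lit _ => (some (.gatherC o m), { oa := put (true, true) })
    -- The input of `merge` already lies on `oa`, left there by the end of `conv`.
    | .merge => (some (.gatherC o m), {})
    | .cst _ | .spl =>
      match t.tab with
      | some (some b) => (some (.load o m), { tab := take, oa := put (b, b) })
      | _ => (some (.gatherC o m), { tab := take })
    | .conj | .conv =>
      match t.tab with
      | some (some b) => (some (.load o m), { tab := take, ob := put (b, b) })
      | _ => (some (.load' o m), { tab := take })
  | .load' o m =>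
    match t.tab with
    | some (some b) => (some (.load' o m), { tab := take, oc := put (b, b) })
    | _ => (some (.zip o m), { tab := take })
  | .zip o m =>
    match t.ob, t.oc with
    | some x, some y => (some (.zip o m), { ob := take, oc := take, wrk := put (x.1, y.1) })
    | _, _ => (some (.next o m), {})
  | .gatherC o m =>
    match t.oc with
    | some x => (some (.gatherC o m), { oc := take, wrk := put x })
    | none => (some (.gatherB o m), {})
  | .gatherB o m =>
    match t.ob with
    | some x => (some (.gatherB o m), { ob := take, wrk := put x })
    | none => (some (.gatherA o m), {})
  | .gatherA o m =>
    match t.oa with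
    | some x => (some (.gatherA o m), { oa := take, wrk := put x })
    | none => (some (.next o m), {})
  | .next o m =>
    match t.col with
    | some c => (some (.pass o m c none none), { col := take })
    | none => (some (.fin o m), {})
  -- `x` and `y` buffer the earlier entries of a chunk until its last entry is read.
  | .pass o m c x y =>
    match t.wrk with
    | none => (some (.gatherC o m), {})
    | some z =>
      match o with
      | .lit _ => emit o m c (entries z z z)
      | .merge =>
        match x, y with
        | none, _ => (some (.pass o m c (some z) none), { wrk := take })
        | some x, none => (some (.pass o m c (some x) (some z)), { wrk := take })
        | some x, some y => emit o m c (entries x y z)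
      | _ =>
        match x with
        | none => (some (.pass o m c (some z) none), { wrk := take })
        | some x => emit o m c (entries x z z)
  | .fin o m =>
    match t.wrk with
    | some x => (some (.fin o m), { wrk := take, oa := put (o.final.eval x, o.final.eval x) })
    | none =>
      match o with
      -- The passes have used up the column, so a second scan supplies a fresh counter for the
      -- merging passes.
      | .conv => (some (.look .merge m false false), {})
      | _ => (some (.save m), { tab := put none })
  | .save m =>
    match t.oa with
    | some x => (some (.save m), { oa := take, tab := put (some x.1) })
    | none => (some (.go m), {})
  | .answer b =>
    match t.tab with
    | some (some b') => (some (.answer b'), { tab := take })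
    | some none => (some (.answer b), { tab := take })
    | none => (some (.erase b), {})
  | .erase b =>
    match t.inp with
    | some _ => (some (.erase b), { inp := take })
    | none => (none, { out := put b })

/-- The transition function of the machine. -/
def machine : Trans Alph Label := fun l t =>
  ((trans l (Tops.of t)).1, (trans l (Tops.of t)).2.get)

/-- The machine gets in at most `n` steps from one configuration to another. -/
def Reach (n : ℕ) (l : Option Label) (s : Mem) (l' : Option Label) (s' : Mem) : Prop :=
  Run machine n l s.get l' s'.get

/-! ### Rules for time-bounded runs -/

theorem Reach.refl (n : ℕ) (l : Option Label) (s : Mem) : Reach n l s l s := Run.refl _ _ _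

theorem get_apply (s : Mem) (a : Acts) : (s.apply a).get = fun k => (a.get k).apply (s.get k) := by
  funext k
  cases k <;> rfl

theorem Reach.step {n : ℕ} {l : Label} {s : Mem} {l' : Option Label} {s' : Mem}
    (h : Reach n (trans l s.tops).1 (s.apply (trans l s.tops).2) l' s') :
    Reach (n + 1) (some l) s l' s' := by
  refine Run.step ?_
  have h' : Run machine n (trans l s.tops).1 (s.apply (trans l s.tops).2).get l' s'.get := h
  rw [get_apply] at h'
  exact h'

theorem Reach.trans {n m : ℕ} {l l' l'' : Option Label} {s s' s'' : Mem}
    (h : Reach n l s l' s') (h' : Reach m l' s' l'' s'') : Reach (n + m) l s l'' s'' := 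
  Run.trans h h'

theorem Reach.mono {n m : ℕ} {l l' : Option Label} {s s' : Mem}
    (h : Reach n l s l' s') (hm : n ≤ m) : Reach m l s l' s' := by
  obtain ⟨d, rfl⟩ := Nat.exists_eq_add_of_le hm
  exact h.trans (Reach.refl _ _ _)

/-- Executes one instruction symbolically: `hl` and `hs` are usually settled by computation, and
`hn` leaves room in the time bound. -/
theorem Reach.head {n m : ℕ} {l : Label} {s : Mem} {l₁ : Option Label} {s₁ : Mem}
    {l' : Option Label} {s' : Mem} (h : Reach n l₁ s₁ l' s') (hl : (PDL.trans l s.tops).1 = l₁)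
    (hs : s.apply (PDL.trans l s.tops).2 = s₁) (hn : n + 1 ≤ m) : Reach m (some l) s l' s' := by
  subst hl hs
  exact h.step.mono hn

theorem Reach.congr {n : ℕ} {l l' : Option Label} {s s' s'' : Mem}
    (h : Reach n l s l' s') (e : s' = s'') : Reach n l s l' s'' := e ▸ h

/-! ### Tables and passes -/

/-- The index vectors with digits from the given lists, in lexicographic order. -/
def idx : List (List Digit) → List (List Digit)
  | [] => [[]]
  | d :: ds => d.flatMap fun a => (idx ds).map (a :: ·)

/-- In lexicographic order the entries that differ only in the last digit are adjacent; these are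
the chunks that a pass consumes. -/
theorem idx_append_singleton (ds : List (List Digit)) (d : List Digit) :
    idx (ds ++ [d]) = (idx ds).flatMap fun v => d.map fun b => v ++ [b] := by
  induction ds with
  | nil => simp [idx, List.map_eq_flatMap]
  | cons e ds ih =>
    simp only [List.cons_append, idx, ih, List.flatMap_assoc, List.map_flatMap, List.flatMap_map,
      List.map_map]
    rfl

theorem length_idx_le {ds : List (List Digit)} (h : ∀ d ∈ ds, d.length ≤ 3) :
    (idx ds).length ≤ 3 ^ ds.length := by
  induction ds with
  | nil => simp [idx]
  | cons d ds ih =>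
    have ih := ih fun d hd => h d (by simp [hd])
    have hd := h d (by simp)
    simp only [idx, List.length_flatMap, List.length_map, List.map_const', List.sum_replicate,
      smul_eq_mul, List.length_cons, pow_succ']
    exact Nat.mul_le_mul hd ih

theorem mem_idx_replicate {k : ℕ} {d v : List Digit} :
    v ∈ idx (List.replicate k d) ↔ v.length = k ∧ ∀ a ∈ v, a ∈ d := by
  induction k generalizing v with
  | zero => cases v <;> simp [idx]
  | succ k ih =>
    cases v with
    | nil => simp [idx, List.replicate_succ]
    | cons a v => simp [idx, List.replicate_succ, ih]; tauto

theorem Op.length_din_le (o : Op) : o.din.length ≤ 3 := by cases o <;> simp [Op.din]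

theorem Op.length_dout_le (o : Op) : o.dout.length ≤ 3 := by cases o <;> simp [Op.dout]

/-- The effect of one pass on the function from index vectors to entries. -/
def Op.pass (o : Op) (c : Bool) (f : List Digit → Bool × Bool) : List Digit → Bool × Bool
  | [] => (false, false)
  | a :: v => o.entry c a fun b => f (v ++ [b])

/-- The effect of a sequence of passes on the function from index vectors to entries. -/
def Op.passes (o : Op) : List Bool → (List Digit → Bool × Bool) → List Digit → Bool × Bool
  | [], f => f
  | c :: cs, f => o.passes cs (o.pass c f)

/-- Moving a stack reverses it, which undoes the reversal caused by pushing the results. `oc` goes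
first and `oa` last, so the block of digit zero ends on top. -/
theorem reach_gather (o : Op) (m : Mode) (s : Mem) :
    Reach (s.oa.length + s.ob.length + s.oc.length + 3) (some (.gatherC o m)) s
      (some (.next o m))
      { s with oa := [], ob := [], oc := []
               wrk := s.oa.reverse ++ (s.ob.reverse ++ (s.oc.reverse ++ s.wrk)) } := by
  rcases s with ⟨inp, out, frm, cnt, rev, nam, aux, col, tab, wrk, oa, ob, oc⟩
  dsimp only
  induction oc generalizing wrk with
  | cons x oc ih =>
    exact ((ih (x :: wrk)).congr (by simp)).head rfl rfl (by simp +arith)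
  | nil =>
    refine Reach.head ?_ rfl rfl (le_refl _)
    change Reach _ (some (.gatherB o m)) ⟨inp, out, frm, cnt, rev, nam, aux, col, tab, wrk, oa, ob, []⟩ _ _
    induction ob generalizing wrk with
    | cons x ob ih =>
      exact ((ih (x :: wrk)).congr (by simp)).head rfl rfl (by simp +arith)
    | nil =>
      refine Reach.head ?_ rfl rfl (le_refl _)
      change Reach _ (some (.gatherA o m)) ⟨inp, out, frm, cnt, rev, nam, aux, col, tab, wrk, oa, [], []⟩ _ _
      induction oa generalizing wrk with
      | cons x oa ih =>
        exact ((ih (x :: wrk)).congr (by simp)).head rfl rfl (by simp +arith)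
      | nil => exact (Reach.refl 0 _ _).head rfl rfl (by simp)

theorem reach_chunk (o : Op) (m : Mode) (c : Bool) (F : Digit → Bool × Bool)
    (w : List (Bool × Bool)) (s : Mem) (hs : s.wrk = o.din.map F ++ w) :
    Reach 3 (some (.pass o m c none none)) s (some (.pass o m c none none))
      { s with wrk := w
               oa := o.entry c .zero F :: s.oa
               ob := o.entry c .one F :: s.ob
               oc := match o with
                | .conv => o.entry c .two F :: s.oc
                | _ => s.oc } := by
  rcases s with ⟨inp, out, frm, cnt, rev, nam, aux, col, tab, wrk, oa, ob, oc⟩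
  dsimp only at hs ⊢
  subst hs
  cases o
  case lit h => exact Reach.head (Reach.refl 2 _ _) rfl rfl (le_refl _)
  case merge =>
    refine Reach.head ?_ rfl rfl (le_refl _)
    refine Reach.head ?_ rfl rfl (le_refl _)
    exact Reach.head (Reach.refl 0 _ _) rfl rfl (le_refl _)
  all_goals
    refine Reach.head ?_ rfl rfl (le_refl _)
    exact Reach.head (Reach.refl 1 _ _) rfl rfl (le_refl _)

theorem reach_pass (o : Op) (m : Mode) (c : Bool) (F : List Digit → Digit → Bool × Bool)
    (L : List (List Digit)) (s : Mem) (hs : s.wrk = L.flatMap fun v => o.din.map (F v)) :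
    Reach (3 * L.length + 1) (some (.pass o m c none none)) s (some (.gatherC o m))
      { s with wrk := []
               oa := (L.map fun v => o.entry c .zero (F v)).reverse ++ s.oa
               ob := (L.map fun v => o.entry c .one (F v)).reverse ++ s.ob
               oc := match o with
                | .conv => (L.map fun v => o.entry c .two (F v)).reverse ++ s.oc
                | _ => s.oc } := by
  induction L generalizing s with
  | nil =>
    rcases s with ⟨inp, out, frm, cnt, rev, nam, aux, col, tab, wrk, oa, ob, oc⟩
    dsimp only [List.flatMap_nil] at hs
    subst hs
    exact ((Reach.refl 0 _ _).congr (by cases o <;> rfl)).head rfl rfl (by simp)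
  | cons v L ih =>
    have h1 := reach_chunk o m c (F v) _ s hs
    refine ((h1.trans (ih _ rfl)).congr ?_).mono (by simp +arith)
    cases o <;> simp

/-- The rotation of indices: the last digit is read within chunks, and its replacement becomes the
first digit because the results are sorted by it. -/
theorem reach_next_pass (o : Op) (m : Mode) (c : Bool) (cs : List Bool)
    (ds : List (List Digit)) (f : List Digit → Bool × Bool) (s : Mem)
    (hw : s.wrk = (idx (ds ++ [o.din])).map f) (hc : s.col = c :: cs)
    (ha : s.oa = []) (hb : s.ob = []) (hoc : s.oc = []) :
    Reach (6 * (idx ds).length + 5) (some (.next o m)) s (some (.next o m))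
      { s with col := cs, wrk := (idx (o.dout :: ds)).map (o.pass c f) } := by
  rcases s with ⟨inp, out, frm, cnt, rev, nam, aux, col, tab, wrk, oa, ob, oc⟩
  dsimp only at hw hc ha hb hoc ⊢
  subst hw hc ha hb hoc
  refine Reach.head (m := 6 * (idx ds).length + 5)
    (l₁ := some (.pass o m c none none)) ?_ rfl rfl (le_refl _)
  have h1 := reach_pass o m c (fun v b => f (v ++ [b])) (idx ds)
    (Mem.apply ⟨inp, out, frm, cnt, rev, nam, aux, c :: cs, tab, (idx (ds ++ [o.din])).map f,
      [], [], []⟩ { col := take }) (by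
      change (idx (ds ++ [o.din])).map f = _
      rw [idx_append_singleton, List.map_flatMap]
      simp only [List.map_map, Function.comp_def])
  refine ((h1.trans (reach_gather o m _)).congr ?_).mono ?_
  · cases o <;>
    simp [Op.dout, idx, Op.pass, Mem.apply, Act.apply, Function.comp_def]
  · cases o <;> simp [Mem.apply, Act.apply] <;> omega

/-- Invariant: the `j` digits already treated are in front with the output alphabet, and the others
follow with the input alphabet. When none are left, the original order of positions is back. -/
theorem reach_passes (o : Op) (m : Mode) (k : ℕ) (cs : List Bool) (j : ℕ) (hk : j + cs.length = k)
    (f : List Digit → Bool × Bool) (s : Mem)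
    (hw : s.wrk = (idx (List.replicate j o.dout ++ List.replicate cs.length o.din)).map f)
    (hc : s.col = cs) (ha : s.oa = []) (hb : s.ob = []) (hoc : s.oc = []) :
    Reach (cs.length * (6 * 3 ^ k + 5) + 1) (some (.next o m)) s (some (.fin o m))
      { s with col := [], wrk := (idx (List.replicate k o.dout)).map (o.passes cs f) } := by
  induction cs generalizing j f s with
  | nil =>
    rcases s with ⟨inp, out, frm, cnt, rev, nam, aux, col, tab, wrk, oa, ob, oc⟩
    dsimp only at hw hc
    subst hw hc hk
    simp only [List.length_nil, List.replicate_zero, List.append_nil, Nat.add_zero, Op.passes]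
    exact (Reach.refl 0 _ _).head rfl rfl (by simp)
  | cons c cs ih =>
    rw [List.length_cons, List.replicate_succ', ← List.append_assoc] at hw
    have h1 := reach_next_pass o m c cs _ f s hw hc ha hb hoc
    refine (h1.trans (ih (j + 1) (by simp at hk; omega) (o.pass c f) _ ?_ rfl ha hb hoc)).mono ?_
    · rw [List.replicate_succ, List.cons_append]
    -- Mixed index lists also have at most three choices per position.
    have h3 : (idx (List.replicate j o.dout ++ List.replicate cs.length o.din)).length ≤ 3 ^ k := by
      refine (length_idx_le ?_).trans (Nat.pow_le_pow_right (by norm_num) ?_)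
      · intro d hd
        simp only [List.mem_append, List.mem_replicate] at hd
        rcases hd with h | h
        · rw [h.2]; exact o.length_dout_le
        · rw [h.2]; exact o.length_din_le
      · simp at hk ⊢; omega
    rw [List.length_cons, Nat.add_one_mul cs.length]
    omega

/-! ### Columns -/

/-- The value in `t` of the listed variable with the given name; `v` if there is none. -/
def lookup (nm : List Bool) (t : ℕ → Bool) (v : Bool) (l : List ℕ) : Bool :=
  l.foldl (fun v y => if Computability.encodeNat y = nm then t y else v) v

theorem lookup_eq_self {nm : List Bool} {t : ℕ → Bool} {v : Bool} {l : List ℕ}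
    (h : ∀ y ∈ l, Computability.encodeNat y ≠ nm) : lookup nm t v l = v := by
  induction l generalizing v with
  | nil => rfl
  | cons y l ih =>
    have hy := h y (by simp)
    simp only [lookup, List.foldl_cons, hy, if_false]
    exact ih fun z hz => h z (by simp [hz])

theorem lookup_encodeNat {x : ℕ} (t : ℕ → Bool) (v : Bool) {l : List ℕ} (hx : x ∈ l) :
    lookup (Computability.encodeNat x) t v l = t x := by
  have inj : ∀ y, Computability.encodeNat y = Computability.encodeNat x → y = x := fun y h => by
    rw [← Computability.decode_encodeNat y, h, Computability.decode_encodeNat]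
  induction l generalizing v with
  | nil => simp at hx
  | cons y l ih =>
    by_cases hxl : x ∈ l
    · exact ih _ hxl
    · obtain rfl : x = y := by simpa [hxl] using hx
      simp only [lookup, List.foldl_cons, if_true]
      refine lookup_eq_self fun y hy h => hxl ?_
      rwa [← inj y h]

/-- The column of values of the variable with the given name, last row first. -/
def column (V : Finset ℕ) (nm : List Bool) (rows : List (ℕ → Bool)) : List Bool :=
  (rows.map fun t => lookup nm t false (V.sort (· ≤ ·))).reverse

/-- The sought name moves to `aux` while it is compared. The names agree exactly if no bit differed
and `nam` is used up at the separator. -/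
theorem reach_look_bits (o : Op) (m : Mode) (v mis : Bool) (l : List Bool) (R : List Sym)
    (s : Mem) (hs : s.inp = l.map Sym.bit ++ Sym.sep :: R) :
    Reach (l.length + 1) (some (.look o m v mis)) s
      (some (.restore o m v (!mis && decide (l = s.nam))))
      { s with inp := R
               rev := Sym.sep :: ((l.map Sym.bit).reverse ++ s.rev)
               nam := s.nam.drop l.length
               aux := (s.nam.take l.length).reverse ++ s.aux } := by
  rcases s with ⟨inp, out, frm, cnt, rev, nam, aux, col, tab, wrk, oa, ob, oc⟩
  dsimp only at hs ⊢
  subst hs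
  induction l generalizing mis rev nam aux with
  | nil => cases nam <;> exact (Reach.refl 0 _ _).head rfl (by simp; rfl) (by simp)
  | cons b l ih =>
    cases nam with
    | nil =>
      -- The sought name has run out before the scanned one, which is a mismatch.
      have := ih true (Sym.bit b :: rev) [] aux
      rw [show (!true && decide (l = [])) = (!mis && decide (b :: l = [])) by simp] at this
      exact (this.congr (by simp)).head rfl rfl (by simp)
    | cons c nam =>
      have := ih (mis || (b != c)) (Sym.bit b :: rev) nam (c :: aux)
      have e : (!(mis || (b != c)) && decide (l = nam)) =
          (!mis && decide (b :: l = c :: nam)) := by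
        cases mis <;> cases b <;> cases c <;> simp
      rw [e] at this
      exact (this.congr (by simp)).head rfl rfl (by simp)

theorem reach_restore (o : Op) (m : Mode) (v mt b : Bool) (R : List Sym)
    (s : Mem) (hs : s.inp = Sym.bit b :: R) :
    Reach (s.aux.length + 1) (some (.restore o m v mt)) s
      (some (.look o m (if mt then b else v) false))
      { s with inp := R
               rev := Sym.bit b :: s.rev
               nam := s.aux.reverse ++ s.nam
               aux := [] } := by
  rcases s with ⟨inp, out, frm, cnt, rev, nam, aux, col, tab, wrk, oa, ob, oc⟩
  dsimp only at hs ⊢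
  subst hs
  induction aux generalizing nam with
  | nil => exact (Reach.refl 0 _ _).head rfl rfl (by simp)
  | cons c aux ih =>
    exact ((ih (c :: nam)).congr (by simp)).head rfl rfl (by simp)

theorem reach_look_vars (o : Op) (m : Mode) (t : ℕ → Bool) (l : List ℕ) (v : Bool) (R : List Sym)
    (s : Mem) (ha : s.aux = [])
    (hs : s.inp = l.flatMap (fun x => encodeVar x ++ [Sym.bit (t x)]) ++ R) :
    Reach ((l.flatMap fun x => encodeVar x ++ [Sym.bit (t x)]).length * (s.nam.length + 1))
      (some (.look o m v false)) s (some (.look o m (lookup s.nam t v l) false))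
      { s with inp := R
               rev := (l.flatMap fun x => encodeVar x ++ [Sym.bit (t x)]).reverse ++ s.rev } := by
  induction l generalizing v s with
  | nil =>
    rcases s with ⟨inp, out, frm, cnt, rev, nam, aux, col, tab, wrk, oa, ob, oc⟩
    dsimp only at hs ⊢
    subst hs
    exact Reach.refl _ _ _
  | cons x l ih =>
    have h1 := reach_look_bits o m v false (Computability.encodeNat x)
      (Sym.bit (t x) :: (l.flatMap (fun x => encodeVar x ++ [Sym.bit (t x)]) ++ R)) s
      (by simp [hs, encodeVar])
    have h2 := h1.trans (reach_restore o m v _ (t x) _ _ rfl)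
    have h3 := ih (if Computability.encodeNat x = s.nam then t x else v)
      { s with inp := l.flatMap (fun x => encodeVar x ++ [Sym.bit (t x)]) ++ R
               rev := (encodeVar x ++ [Sym.bit (t x)]).reverse ++ s.rev } ha rfl
    simp only [Bool.not_false, Bool.true_and, decide_eq_true_eq] at h2
    have h4 := h2.congr (s'' := { s with
      inp := l.flatMap (fun x => encodeVar x ++ [Sym.bit (t x)]) ++ R
      rev := (encodeVar x ++ [Sym.bit (t x)]).reverse ++ s.rev }) (by simp [ha, encodeVar])
    refine ((h4.trans h3).congr (by simp)).mono ?_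
    simp only [List.length_append, List.length_reverse, List.length_take, ha, List.length_nil,
      List.flatMap_cons, encodeVar, List.length_map, List.length_cons]
    rw [Nat.add_mul _ _ (s.nam.length + 1)]
    gcongr
    have : min (Computability.encodeNat x).length s.nam.length ≤ s.nam.length := by omega
    nlinarith

theorem reach_look_rows (o : Op) (m : Mode) (V : Finset ℕ) (rows : List (ℕ → Bool))
    (s : Mem) (ha : s.aux = []) (hs : s.inp = rows.flatMap (encodeAssignment V)) :
    Reach (s.inp.length * (s.nam.length + 1) + 1)
      (some (.look o m false false)) s (some (.rewind o m))
      { s with inp := []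
               rev := s.inp.reverse ++ s.rev
               col := column V s.nam rows ++ s.col } := by
  induction rows generalizing s with
  | nil =>
    rcases s with ⟨inp, out, frm, cnt, rev, nam, aux, col, tab, wrk, oa, ob, oc⟩
    dsimp only at hs ha ⊢
    subst hs
    exact (Reach.refl 0 _ _).head rfl rfl (by simp)
  | cons t rows ih =>
    have h1 := reach_look_vars o m t (V.sort (· ≤ ·)) false
      (Sym.close :: rows.flatMap (encodeAssignment V)) s ha (by simp [hs, encodeAssignment])
    have h2 := ih { s with
      inp := rows.flatMap (encodeAssignment V)
      rev := (encodeAssignment V t).reverse ++ s.rev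
      col := lookup s.nam t false (V.sort (· ≤ ·)) :: s.col } ha rfl
    have h3 := h1.trans (h2.head rfl (by simp [encodeAssignment]; rfl) (le_refl _))
    refine (h3.congr (by simp [hs, column])).mono ?_
    simp only [hs, List.flatMap_cons, List.length_append, encodeAssignment, List.length_cons,
      List.length_nil]
    nlinarith

theorem reach_rewind (o : Op) (m : Mode) (s : Mem) :
    Reach (s.rev.length + 1) (some (.rewind o m)) s (some (.clear o m))
      { s with inp := s.rev.reverse ++ s.inp, rev := [] } := by
  rcases s with ⟨inp, out, frm, cnt, rev, nam, aux, col, tab, wrk, oa, ob, oc⟩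
  dsimp only
  induction rev generalizing inp with
  | nil => exact (Reach.refl 0 _ _).head rfl rfl (by simp)
  | cons a rev ih =>
    exact ((ih (a :: inp)).congr (by simp)).head rfl rfl (by simp)

theorem reach_clear (o : Op) (m : Mode) (s : Mem) :
    Reach (s.nam.length + 1) (some (.clear o m)) s (some (.load o m)) { s with nam := [] } := by
  rcases s with ⟨inp, out, frm, cnt, rev, nam, aux, col, tab, wrk, oa, ob, oc⟩
  dsimp only
  induction nam with
  | nil => exact (Reach.refl 0 _ _).head rfl rfl (by simp)
  | cons a nam ih =>
    exact (ih.congr (by simp)).head rfl rfl (by simp)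

theorem reach_column (o : Op) (m : Mode) (V : Finset ℕ) (rows : List (ℕ → Bool))
    (s : Mem) (ha : s.aux = []) (hr : s.rev = []) (hc : s.col = [])
    (hs : s.inp = rows.flatMap (encodeAssignment V)) :
    Reach (4 * ((s.inp.length + 1) * (s.nam.length + 1)))
      (some (.look o m false false)) s (some (.load o m))
      { s with nam := [], col := column V s.nam rows } := by
  have h := ((reach_look_rows o m V rows s ha hs).trans (reach_rewind o m _)).trans
    (reach_clear o m _)
  refine (h.congr (by simp [hr, hc])).mono ?_
  simp only [hr, List.append_nil, List.length_reverse]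
  nlinarith

theorem length_column (V : Finset ℕ) (nm : List Bool) (rows : List (ℕ → Bool)) :
    (column V nm rows).length = rows.length := by
  simp [column]

/-! ### Operations on tables -/

/-- A table, with `k` binary digits in the indices, on top of a stack. -/
def pushTable (k : ℕ) (D : List Digit → Bool) (τ : List (Option Bool)) : List (Option Bool) :=
  (idx (List.replicate k [.zero, .one])).map (fun v => some (D v)) ++ none :: τ

theorem reach_fin (o : Op) (ho : o ≠ .conv) (m : Mode) (s : Mem) :
    Reach (s.wrk.length + 1) (some (.fin o m)) s (some (.save m))
      { s with wrk := []
               oa := (s.wrk.map fun x => (o.final.eval x, o.final.eval x)).reverse ++ s.oa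
               tab := none :: s.tab } := by
  rcases s with ⟨inp, out, frm, cnt, rev, nam, aux, col, tab, wrk, oa, ob, oc⟩
  dsimp only
  induction wrk generalizing oa with
  | nil =>
    cases o
    case conv => exact absurd rfl ho
    all_goals exact (Reach.refl 0 _ _).head rfl rfl (by simp)
  | cons x w ih =>
    exact ((ih ((o.final.eval x, o.final.eval x) :: oa)).congr (by simp)).head rfl rfl (by simp)

theorem reach_save (m : Mode) (s : Mem) :
    Reach (s.oa.length + 1) (some (.save m)) s (some (.go m))
      { s with oa := [], tab := (s.oa.map fun x => some x.1).reverse ++ s.tab } := by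
  rcases s with ⟨inp, out, frm, cnt, rev, nam, aux, col, tab, wrk, oa, ob, oc⟩
  dsimp only
  induction oa generalizing tab with
  | nil => exact (Reach.refl 0 _ _).head rfl rfl (by simp)
  | cons x w ih =>
    exact ((ih (some x.1 :: tab)).congr (by simp)).head rfl rfl (by simp)

theorem reach_passes_save (o : Op) (ho : o ≠ .conv) (m : Mode) (cs : List Bool)
    (f : List Digit → Bool × Bool) (s : Mem)
    (hw : s.wrk = (idx (List.replicate cs.length o.din)).map f)
    (hc : s.col = cs) (ha : s.oa = []) (hb : s.ob = []) (hoc : s.oc = []) :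
    Reach (cs.length * (6 * 3 ^ cs.length + 5) + 2 * 3 ^ cs.length + 3) (some (.next o m)) s
      (some (.go m))
      { s with
        col := []
        wrk := []
        tab := pushTable cs.length (fun v => o.final.eval (o.passes cs f v)) s.tab } := by
  have h := ((reach_passes o m _ cs 0 (Nat.zero_add _) f s (by simpa using hw) hc ha hb hoc).trans
    (reach_fin o ho m _)).trans (reach_save m _)
  have hd : o.dout = [.zero, .one] := by cases o <;> first | rfl | exact absurd rfl ho
  refine (h.congr ?_).mono ?_
  · simp [ha, hd, pushTable, Function.comp_def]
  · have : (idx (List.replicate cs.length o.dout)).length ≤ 3 ^ cs.length := by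
      simpa using length_idx_le (ds := List.replicate cs.length o.dout) fun d hd => by
        rw [(List.mem_replicate.1 hd).2]; exact o.length_dout_le
    simp [ha]
    omega

/-- The memory between two operations: the rows, the rest of the formula, the name of a variable,
and tables. -/
abbrev memory (V : Finset ℕ) (rows : List (ℕ → Bool)) (f : List Sym) (nm : List Bool)
    (τ : List (Option Bool)) : Mem :=
  { inp := rows.flatMap (encodeAssignment V), frm := f, nam := nm, tab := τ }

/-- A bound for the time of an operation. -/
def opTime (R k n : ℕ) : ℕ := 8 * ((R + 1) * (n + 1)) + (k + 1) * (40 * 3 ^ k)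

theorem length_idx_replicate_le (k : ℕ) {d : List Digit} (hd : d.length ≤ 3) :
    (idx (List.replicate k d)).length ≤ 3 ^ k := by
  simpa using length_idx_le (ds := List.replicate k d) fun e he => by
    rw [(List.mem_replicate.1 he).2]; exact hd

theorem idx_replicate_singleton (k : ℕ) (a : Digit) :
    idx (List.replicate k [a]) = [List.replicate k a] := by
  induction k with
  | zero => rfl
  | succ k ih => simp [List.replicate_succ, idx, ih]

theorem reach_load_unary (o : Op) (ho : o.dout = [.zero, .one]) (hi : o.din = [.zero, .one])
    (hc : o ≠ .conj) (m : Mode) (l : List Bool) (τ : List (Option Bool))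
    (s : Mem) (hs : s.tab = l.map some ++ none :: τ) :
    Reach (l.length + 1) (some (.load o m)) s (some (.gatherC o m))
      { s with tab := τ, oa := (l.map fun b => (b, b)).reverse ++ s.oa } := by
  rcases s with ⟨inp, out, frm, cnt, rev, nam, aux, col, tab, wrk, oa, ob, oc⟩
  dsimp only at hs ⊢
  subst hs
  induction l generalizing oa with
  | nil =>
    cases o <;> first
      | exact (Reach.refl 0 _ _).head rfl rfl (by simp)
      | simp [Op.dout, Op.din] at ho hi hc
  | cons b l ih =>
    cases o <;> first
      | exact ((ih ((b, b) :: oa)).congr (by simp)).head rfl rfl (by simp)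
      | simp [Op.dout, Op.din] at ho hi hc

theorem reach_load_binary (o : Op) (ho : o = .conj ∨ o = .conv) (m : Mode) (l : List Bool)
    (τ : List (Option Bool)) (s : Mem) (hs : s.tab = l.map some ++ none :: τ) :
    Reach (l.length + 1) (some (.load o m)) s (some (.load' o m))
      { s with tab := τ, ob := (l.map fun b => (b, b)).reverse ++ s.ob } := by
  rcases s with ⟨inp, out, frm, cnt, rev, nam, aux, col, tab, wrk, oa, ob, oc⟩
  dsimp only at hs ⊢
  subst hs
  induction l generalizing ob with
  | nil => rcases ho with rfl | rfl <;> exact (Reach.refl 0 _ _).head rfl rfl (by simp)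
  | cons b l ih =>
    rcases ho with rfl | rfl <;>
      exact ((ih ((b, b) :: ob)).congr (by simp)).head rfl rfl (by simp)

theorem reach_load' (o : Op) (m : Mode) (l : List Bool)
    (τ : List (Option Bool)) (s : Mem) (hs : s.tab = l.map some ++ none :: τ) :
    Reach (l.length + 1) (some (.load' o m)) s (some (.zip o m))
      { s with tab := τ, oc := (l.map fun b => (b, b)).reverse ++ s.oc } := by
  rcases s with ⟨inp, out, frm, cnt, rev, nam, aux, col, tab, wrk, oa, ob, oc⟩
  dsimp only at hs ⊢
  subst hs
  induction l generalizing oc with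
  | nil => exact (Reach.refl 0 _ _).head rfl rfl (by simp)
  | cons b l ih => exact ((ih ((b, b) :: oc)).congr (by simp)).head rfl rfl (by simp)

theorem reach_zip (o : Op) (m : Mode) (l : List (List Digit)) (F G : List Digit → Bool)
    (s : Mem) (hb : s.ob = l.map fun v => (F v, F v)) (hc : s.oc = l.map fun v => (G v, G v)) :
    Reach (l.length + 1) (some (.zip o m)) s (some (.next o m))
      { s with ob := [], oc := [], wrk := (l.map fun v => (F v, G v)).reverse ++ s.wrk } := by
  rcases s with ⟨inp, out, frm, cnt, rev, nam, aux, col, tab, wrk, oa, ob, oc⟩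
  dsimp only at hb hc ⊢
  subst hb hc
  induction l generalizing wrk with
  | nil => exact (Reach.refl 0 _ _).head rfl rfl (by simp)
  | cons v l ih => exact ((ih ((F v, G v) :: wrk)).congr (by simp)).head rfl rfl (by simp)

/-- Both tables arrive on `ob` and `oc` in reverse order, and zipping them onto `wrk` restores the
order. -/
theorem reach_load_zip (o : Op) (ho : o = .conj ∨ o = .conv) (m : Mode) (k : ℕ)
    (F G : List Digit → Bool) (τ : List (Option Bool)) (s : Mem)
    (hs : s.tab = pushTable k F (pushTable k G τ)) (hb : s.ob = []) (hc : s.oc = []) :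
    Reach (3 * 3 ^ k + 3) (some (.load o m)) s (some (.next o m))
      { s with
        tab := τ
        wrk := (idx (List.replicate k [.zero, .one])).map (fun v => (F v, G v)) ++ s.wrk } := by
  have h1 := reach_load_binary o ho m ((idx (List.replicate k [.zero, .one])).map F)
    (pushTable k G τ) s (by simp [hs, pushTable])
  have h2 := h1.trans (reach_load' o m ((idx (List.replicate k [.zero, .one])).map G) τ _
    (by simp [pushTable]))
  have h3 := h2.trans (reach_zip o m (idx (List.replicate k [.zero, .one])).reverse F G _
    (by simp [hb, List.map_reverse]) (by simp [hc, List.map_reverse]))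
  refine (h3.congr (by simp [hb, hc, List.map_reverse])).mono ?_
  have := length_idx_replicate_le k (d := [.zero, .one]) (by simp)
  simp
  omega

section

variable (V : Finset ℕ) (rows : List (ℕ → Bool)) (f : List Sym) (τ : List (Option Bool))

/-- The work list starts as a single pair. Each pass reads one digit and writes two, so `k` passes
build a table with `2 ^ k` entries. -/
theorem reach_lit (h : Final) (m : Mode) (nm : List Bool) :
    Reach (opTime (rows.flatMap (encodeAssignment V)).length rows.length nm.length)
      (some (.look (.lit h) m false false)) (memory V rows f nm τ) (some (.go m))
      (memory V rows f [] (pushTable rows.length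
        (fun v => h.eval ((Op.lit h).passes (column V nm rows) (fun _ => (true, true)) v)) τ)) := by
  have h1 := reach_column (.lit h) m V rows (memory V rows f nm τ) rfl rfl rfl rfl
  have h2 := h1.trans (Reach.head (reach_gather (.lit h) m
    { memory V rows f [] τ with col := column V nm rows, oa := [(true, true)] }) rfl rfl (le_refl _))
  have h3 := h2.trans (reach_passes_save (.lit h) (by simp) m _ (fun _ => (true, true)) _
    (by simp [Op.din, idx_replicate_singleton]) rfl rfl rfl rfl)
  simp only [length_column] at h3
  refine h3.mono ?_
  unfold opTime
  have : 1 ≤ 3 ^ rows.length := Nat.one_le_pow _ _ (by norm_num)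
  simp only [List.length_cons, List.length_nil]
  nlinarith

theorem reach_unary (o : Op) (ho : o.dout = [.zero, .one]) (hi : o.din = [.zero, .one])
    (hc : o ≠ .conj) (m : Mode) (nm : List Bool) (D : List Digit → Bool) :
    Reach (opTime (rows.flatMap (encodeAssignment V)).length rows.length nm.length)
      (some (.look o m false false)) (memory V rows f nm (pushTable rows.length D τ)) (some (.go m))
      (memory V rows f [] (pushTable rows.length
        (fun v => o.final.eval (o.passes (column V nm rows) (fun v => (D v, D v)) v)) τ)) := by
  have h1 := reach_column o m V rows (memory V rows f nm (pushTable rows.length D τ)) rfl rfl rfl rfl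
  have h2 := h1.trans (reach_load_unary o ho hi hc m
    ((idx (List.replicate rows.length [.zero, .one])).map D) τ _ (by simp [pushTable]))
  have h3 := h2.trans (reach_gather o m _)
  have h4 := h3.trans (reach_passes_save o (by rintro rfl; simp [Op.dout] at ho) m _
    (fun v => (D v, D v)) _ (by simp [hi, length_column]) rfl rfl rfl rfl)
  simp only [length_column] at h4
  refine h4.mono ?_
  unfold opTime
  have h5 : 1 ≤ 3 ^ rows.length := Nat.one_le_pow _ _ (by norm_num)
  have h6 := length_idx_replicate_le rows.length (d := [.zero, .one]) (by simp)
  simp only [List.length_append, List.length_reverse, List.length_map, List.length_nil]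
  nlinarith

theorem reach_conj (m : Mode) (F G : List Digit → Bool) (n : ℕ) :
    Reach (opTime (rows.flatMap (encodeAssignment V)).length rows.length n)
      (some (.load .conj m))
      (memory V rows f [] (pushTable rows.length F (pushTable rows.length G τ))) (some (.go m))
      (memory V rows f [] (pushTable rows.length (fun v => F v && G v) τ)) := by
  have h1 := reach_load_zip .conj (.inl rfl) m rows.length F G τ
    (memory V rows f [] (pushTable rows.length F (pushTable rows.length G τ))) rfl rfl rfl
  -- No column was loaded, so there are no passes to perform.
  have h2 := h1.trans (Reach.head (Reach.refl 0 _ _) (l₁ := some (.fin .conj m)) rfl rfl (le_refl _))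
  have h3 := (h2.trans (reach_fin .conj (by simp) m _)).trans (reach_save m _)
  refine (h3.congr ?_).mono ?_
  · simp [pushTable, Mem.apply, PDL.trans, Act.apply, Mem.tops, Op.final, Final.eval,
      Function.comp_def]
  · unfold opTime
    have h5 : 1 ≤ 3 ^ rows.length := Nat.one_le_pow _ _ (by norm_num)
    have h6 := length_idx_replicate_le rows.length (d := [.zero, .one]) (by simp)
    have h7 : 40 * 3 ^ rows.length ≤ (rows.length + 1) * (40 * 3 ^ rows.length) :=
      Nat.le_mul_of_pos_left _ (by omega)
    refine le_trans ?_ (Nat.le_add_left _ _)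
    clear h1 h2 h3
    simp [Mem.apply, PDL.trans, Act.apply, Mem.tops]
    omega

theorem reach_fin_conv (m : Mode) (s : Mem) :
    Reach (s.wrk.length + 1) (some (.fin .conv m)) s (some (.look .merge m false false))
      { s with wrk := []
               oa := (s.wrk.map fun x => (x.1 && x.2, x.1 && x.2)).reverse ++ s.oa } := by
  rcases s with ⟨inp, out, frm, cnt, rev, nam, aux, col, tab, wrk, oa, ob, oc⟩
  dsimp only
  induction wrk generalizing oa with
  | nil => exact (Reach.refl 0 _ _).head rfl rfl (by simp)
  | cons x w ih =>
    exact ((ih ((x.1 && x.2, x.1 && x.2) :: oa)).congr (by simp)).head rfl rfl (by simp)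

/-- Expand to indices of splits, conjoin the two components of each entry, then merge. Neither
`conv` nor `merge` looks at the bits of the column: it only counts the passes, so it may be computed
from the empty name. -/
theorem reach_conv (m : Mode) (F G : List Digit → Bool) :
    Reach (opTime (rows.flatMap (encodeAssignment V)).length rows.length 0)
      (some (.look .conv m false false))
      (memory V rows f [] (pushTable rows.length F (pushTable rows.length G τ))) (some (.go m))
      (memory V rows f [] (pushTable rows.length (fun v =>
        (Op.merge.passes (column V [] rows) (fun w =>
          let x := Op.conv.passes (column V [] rows) (fun v => (F v, G v)) w
          (x.1 && x.2, x.1 && x.2)) v).1) τ)) := by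
  have h1 := reach_column .conv m V rows
    (memory V rows f [] (pushTable rows.length F (pushTable rows.length G τ))) rfl rfl rfl rfl
  have h2 := h1.trans (reach_load_zip .conv (.inr rfl) m rows.length F G τ _ rfl rfl rfl)
  have h3 := h2.trans (reach_passes .conv m rows.length (column V [] rows) 0
    (by simp [length_column]) (fun v => (F v, G v)) _ (by simp [Op.din, length_column])
    rfl rfl rfl rfl)
  have h4 := h3.trans (reach_fin_conv m _)
  have h5 := h4.trans (reach_column .merge m V rows _ rfl rfl rfl rfl)
  have h6 := h5.trans (Reach.head (reach_gather .merge m _) rfl rfl (le_refl _))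
  have h7 := h6.trans (reach_passes_save .merge (by simp) m (column V [] rows) (fun w =>
          let x := Op.conv.passes (column V [] rows) (fun v => (F v, G v)) w
          (x.1 && x.2, x.1 && x.2)) _ ?_ rfl rfl rfl rfl)
  · simp only [length_column] at h7
    refine h7.mono ?_
    unfold opTime
    have h8 : 1 ≤ 3 ^ rows.length := Nat.one_le_pow _ _ (by norm_num)
    have h9 := length_idx_replicate_le rows.length (d := Op.conv.dout) (by simp [Op.dout])
    simp [Mem.apply, PDL.trans, Act.apply]
    nlinarith
  · simp [Mem.apply, PDL.trans, Act.apply, length_column, Op.din, Op.dout]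

end

/-! ### Sequences of passes in closed form -/

/-- Every bit at a nonzero digit is `true`. -/
def forced (a : List Digit) (cs : List Bool) : Bool :=
  (a.zip cs).all fun p => decide (p.1 = .zero) || p.2

/-- The induction needs indices of the form `a.reverse ++ v`: `a` lists the digits in the order in
which the passes treat them, matching `cs`, and `v` is the untouched remainder. Only digit zero is
ever read, hence the zeros in the argument of `f`. -/
theorem passes_lit (h : Final) (cs : List Bool) (a v : List Digit) (hl : a.length = cs.length)
    (f : List Digit → Bool × Bool) :
    (Op.lit h).passes cs f (a.reverse ++ v) =
      ((f (v ++ List.replicate cs.length .zero)).1 && forced a cs,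
        (f (v ++ List.replicate cs.length .zero)).2 && forced a (cs.map not)) := by
  induction cs generalizing a v f with
  | nil =>
    obtain rfl := List.length_eq_zero_iff.1 hl
    simp [Op.passes, forced]
  | cons c cs ih =>
    obtain ⟨d, a, rfl⟩ := List.exists_cons_of_length_eq_add_one hl
    rw [List.reverse_cons, List.append_assoc, List.singleton_append]
    simp only [Op.passes]
    rw [ih a (d :: v) (by simpa using hl)]
    cases d <;>
      simp [Op.pass, Op.entry, forced, List.replicate_succ', Bool.and_assoc]

theorem passes_cst (h : Final) (cs : List Bool) (a v : List Digit) (hl : a.length = cs.length)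
    (ha : ∀ d ∈ a, d ≠ .two) (f : List Digit → Bool × Bool) :
    (Op.cst h).passes cs f (a.reverse ++ v) =
      ((f (v ++ a.reverse)).1 && forced a cs, (f (v ++ a.reverse)).2 && forced a (cs.map not)) := by
  induction cs generalizing a v f with
  | nil =>
    obtain rfl := List.length_eq_zero_iff.1 hl
    simp [Op.passes, forced]
  | cons c cs ih =>
    obtain ⟨d, a, rfl⟩ := List.exists_cons_of_length_eq_add_one hl
    rw [List.reverse_cons, List.append_assoc, List.singleton_append]
    simp only [Op.passes]
    rw [ih a (d :: v) (by simpa using hl) fun d hd => ha d (by simp [hd])]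
    have hd := ha d (by simp)
    cases d <;> simp [Op.pass, Op.entry, forced, Bool.and_assoc] at hd ⊢

/-- A digit, replaced by zero unless the bit is `true`. -/
def keep (d : Digit) (c : Bool) : Digit := if c then d else .zero

/-- The first component keeps the members with bit `true` and the second those with bit `false`, by
zeroing the digits of all others. -/
theorem passes_spl (cs : List Bool) (a v : List Digit) (hl : a.length = cs.length)
    (ha : ∀ d ∈ a, d ≠ .two) (f : List Digit → Bool × Bool) :
    Op.spl.passes cs f (a.reverse ++ v) =
      ((f (v ++ (List.zipWith keep a cs).reverse)).1,
        (f (v ++ (List.zipWith keep a (cs.map not)).reverse)).2) := by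
  induction cs generalizing a v f with
  | nil =>
    obtain rfl := List.length_eq_zero_iff.1 hl
    simp [Op.passes]
  | cons c cs ih =>
    obtain ⟨d, a, rfl⟩ := List.exists_cons_of_length_eq_add_one hl
    rw [List.reverse_cons, List.append_assoc, List.singleton_append]
    simp only [Op.passes]
    rw [ih a (d :: v) (by simpa using hl) fun d hd => ha d (by simp [hd])]
    have hd := ha d (by simp)
    cases d <;> cases c <;> simp [Op.pass, Op.entry, keep] at hd ⊢

/-- The digit of the first part of a split team. -/
def Digit.left : Digit → Digit
  | .one => .one
  | _ => .zero

/-- The digit of the second part of a split team. -/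
def Digit.right : Digit → Digit
  | .two => .one
  | _ => .zero

/-- The digit of a split team. -/
def Digit.join : Digit → Digit
  | .zero => .zero
  | _ => .one

/-- Each ternary digit is projected to membership in the left part for the first component and in
the right part for the second. -/
theorem passes_conv (cs : List Bool) (a v : List Digit) (hl : a.length = cs.length)
    (f : List Digit → Bool × Bool) :
    Op.conv.passes cs f (a.reverse ++ v) =
      ((f (v ++ (a.map Digit.left).reverse)).1, (f (v ++ (a.map Digit.right).reverse)).2) := by
  induction cs generalizing a v f with
  | nil =>
    obtain rfl := List.length_eq_zero_iff.1 hl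
    simp [Op.passes]
  | cons c cs ih =>
    obtain ⟨d, a, rfl⟩ := List.exists_cons_of_length_eq_add_one hl
    rw [List.reverse_cons, List.append_assoc, List.singleton_append]
    simp only [Op.passes]
    rw [ih a (d :: v) (by simpa using hl)]
    cases d <;> simp [Op.pass, Op.entry, Digit.left, Digit.right]

/-- Digits one and two of each position are combined by a disjunction, so `k` passes compute an
existential quantifier over the preimages under `Digit.join`. -/
theorem passes_merge (cs : List Bool) (a v : List Digit) (hl : a.length = cs.length)
    (ha : ∀ d ∈ a, d ≠ .two) (f : List Digit → Bool × Bool) :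
    (Op.merge.passes cs f (a.reverse ++ v)).1 = true ↔
      ∃ w : List Digit, w.map Digit.join = a ∧ (f (v ++ w.reverse)).1 = true := by
  induction cs generalizing a v f with
  | nil =>
    obtain rfl := List.length_eq_zero_iff.1 hl
    simp [Op.passes]
  | cons c cs ih =>
    obtain ⟨d, a, rfl⟩ := List.exists_cons_of_length_eq_add_one hl
    rw [List.reverse_cons, List.append_assoc, List.singleton_append]
    simp only [Op.passes]
    rw [ih a (d :: v) (by simpa using hl) fun d hd => ha d (by simp [hd])]
    have hd := ha d (by simp)
    constructor
    · rintro ⟨w, rfl, hw⟩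
      cases d
      case zero => exact ⟨.zero :: w, by simp [Digit.join], by simpa [Op.pass, Op.entry] using hw⟩
      case two => exact absurd rfl hd
      case one =>
        simp only [Op.pass, Op.entry, List.cons_append, Bool.or_eq_true] at hw
        rcases hw with hw | hw
        · exact ⟨.one :: w, by simp [Digit.join], by simpa using hw⟩
        · exact ⟨.two :: w, by simp [Digit.join], by simpa using hw⟩
    · rintro ⟨w, hw, hf⟩
      obtain ⟨e, w, rfl, rfl, rfl⟩ := List.map_eq_cons_iff.1 hw
      refine ⟨w, rfl, ?_⟩
      cases e <;> simp_all [Op.pass, Op.entry, Digit.join]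

/-! ### Tables indexed by subteams -/

/-- The subteam with the given index. -/
def subteam (rows : List (ℕ → Bool)) (v : List Digit) : Set (ℕ → Bool) :=
  {t | (t, Digit.one) ∈ rows.zip v}

/-- `forced` treats all nonzero digits alike whereas `subteam` counts only digit one; without digit
two both speak of the same rows. -/
theorem forced_iff (rows : List (ℕ → Bool)) (v : List Digit) (hv : ∀ d ∈ v, d ≠ .two)
    (c : (ℕ → Bool) → Bool) :
    forced v (rows.map c) = true ↔ ∀ t ∈ subteam rows v, c t = true := by
  induction rows generalizing v with
  | nil => simp [forced, subteam]
  | cons s rows ih =>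
    cases v with
    | nil => simp [forced, subteam]
    | cons d v =>
      have ih := ih v fun d hd => hv d (by simp [hd])
      have hd := hv d (by simp)
      simp only [forced, subteam, Set.mem_ofPred_eq] at ih
      cases d <;> simp [forced, subteam, ih] at hd ⊢

theorem subteam_zipWith_keep (rows : List (ℕ → Bool)) (v : List Digit) (c : (ℕ → Bool) → Bool) :
    subteam rows (List.zipWith keep v (rows.map c)) = {t ∈ subteam rows v | c t = true} := by
  induction rows generalizing v with
  | nil => simp [subteam]
  | cons s rows ih =>
    cases v with
    | nil => simp [subteam]
    | cons d v =>
      have ih := ih v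
      ext t
      have ih := Set.ext_iff.1 ih t
      simp only [subteam, Set.mem_ofPred_eq] at ih
      simp only [subteam, Set.mem_ofPred_eq, List.map_cons, List.zipWith_cons_cons,
        List.zip_cons_cons, List.mem_cons, Prod.mk.injEq, ih, keep]
      by_cases hts : t = s
      · subst hts
        cases h : c t <;> simp
      · simp [hts]

theorem mem_zip_zipWith (rows : List (ℕ → Bool)) (v : List Digit)
    (h : (ℕ → Bool) → Digit → Digit) (t : ℕ → Bool) (e : Digit) :
    (t, e) ∈ rows.zip (List.zipWith h rows v) ↔ ∃ d, (t, d) ∈ rows.zip v ∧ e = h t d := by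
  induction rows generalizing v with
  | nil => simp
  | cons s rows ih =>
    cases v with
    | nil => simp
    | cons d v =>
      simp only [List.zipWith_cons_cons, List.zip_cons_cons, List.mem_cons, Prod.mk.injEq, ih]
      constructor
      · rintro (⟨rfl, rfl⟩ | ⟨d', h1, h2⟩)
        · exact ⟨d, .inl ⟨rfl, rfl⟩, rfl⟩
        · exact ⟨d', .inr h1, h2⟩
      · rintro ⟨d', ⟨rfl, rfl⟩ | h1, h2⟩
        · exact .inl ⟨rfl, h2⟩
        · exact .inr ⟨d', h1, h2⟩

theorem mem_subteam_map (rows : List (ℕ → Bool)) (w : List Digit) (g : Digit → Digit)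
    (t : ℕ → Bool) : t ∈ subteam rows (w.map g) ↔ ∃ d, (t, d) ∈ rows.zip w ∧ g d = .one := by
  simp only [subteam, Set.mem_ofPred_eq, List.zip_map_right, List.mem_map, Prod.exists, Prod.map,
    Prod.mk.injEq, id]
  constructor
  · rintro ⟨s, d, h, rfl, e⟩; exact ⟨d, h, e⟩
  · rintro ⟨d, h, e⟩; exact ⟨t, d, h, rfl, e⟩

/-- A word over three digits encodes a disjoint split. A split with overlap reduces to one by giving
the common assignments to the left part, which is harmless because the properties pass to subteams.
-/
theorem exists_split_iff (rows : List (ℕ → Bool)) (v : List Digit) (hl : v.length = rows.length)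
    (hv : ∀ d ∈ v, d ≠ .two) (Q₁ Q₂ : Set (ℕ → Bool) → Prop)
    (h₁ : ∀ S T, S ⊆ T → Q₁ T → Q₁ S) (h₂ : ∀ S T, S ⊆ T → Q₂ T → Q₂ S) :
    (∃ w : List Digit, w.map Digit.join = v ∧ Q₁ (subteam rows (w.map Digit.left)) ∧
      Q₂ (subteam rows (w.map Digit.right))) ↔
    ∃ T₁ T₂, T₁ ∪ T₂ = subteam rows v ∧ Q₁ T₁ ∧ Q₂ T₂ := by
  classical
  constructor
  · rintro ⟨w, rfl, hq₁, hq₂⟩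
    refine ⟨_, _, ?_, hq₁, hq₂⟩
    ext t
    simp only [Set.mem_union, mem_subteam_map]
    constructor
    · rintro (⟨d, h, e⟩ | ⟨d, h, e⟩) <;> refine ⟨d, h, ?_⟩ <;> cases d <;>
        simp [Digit.left, Digit.right, Digit.join] at e ⊢
    · rintro ⟨d, h, e⟩
      cases d
      · simp [Digit.join] at e
      · exact .inl ⟨_, h, rfl⟩
      · exact .inr ⟨_, h, rfl⟩
  · rintro ⟨T₁, T₂, hT, hq₁, hq₂⟩
    -- Members of `T₁` go left and all other members of the subteam go right.
    let g : (ℕ → Bool) → Digit → Digit := fun t d =>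
      if d = .one then (if t ∈ T₁ then .one else .two) else .zero
    refine ⟨List.zipWith g rows v, ?_, h₁ _ _ ?_ hq₁, h₂ _ _ ?_ hq₂⟩
    · clear hT
      induction v generalizing rows with
      | nil => simp
      | cons d v ih =>
        obtain ⟨t, rows, rfl⟩ := List.exists_cons_of_length_eq_add_one hl.symm
        have hd := hv d (by simp)
        rw [List.zipWith_cons_cons, List.map_cons,
          ih rows (by simpa using hl) fun d hd => hv d (by simp [hd])]
        congr 1
        by_cases ht : t ∈ T₁ <;> cases d <;> simp [g, Digit.join, ht] at hd ⊢
    · intro t ht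
      obtain ⟨e, he, hg⟩ := (mem_subteam_map _ _ _ _).1 ht
      obtain ⟨d, -, rfl⟩ := (mem_zip_zipWith _ _ _ _ _).1 he
      by_contra hn
      by_cases hd : d = .one <;> simp [g, hd, hn, Digit.left] at hg
    · intro t ht
      obtain ⟨e, he, hg⟩ := (mem_subteam_map _ _ _ _).1 ht
      obtain ⟨d, hd, rfl⟩ := (mem_zip_zipWith _ _ _ _ _).1 he
      by_cases hd1 : d = .one
      · subst hd1
        by_cases hn : t ∈ T₁
        · simp [g, hn, Digit.right] at hg
        · have : t ∈ T₁ ∪ T₂ := hT ▸ hd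
          exact this.resolve_left hn
      · simp [g, hd1, Digit.right] at hg

open Classical in
/-- The table of the subteams with property `Q`, on top of a stack. -/
noncomputable def teamTable (rows : List (ℕ → Bool)) (Q : Set (ℕ → Bool) → Prop)
    (τ : List (Option Bool)) : List (Option Bool) :=
  pushTable rows.length (fun v => decide (Q (subteam rows v))) τ

open Classical in
-- The listed indices are exactly the binary words with one digit per row, so `D` matters only
-- there.
theorem pushTable_eq_teamTable {rows : List (ℕ → Bool)} {D : List Digit → Bool}
    {Q : Set (ℕ → Bool) → Prop} (τ : List (Option Bool))
    (h : ∀ v : List Digit, v.length = rows.length → (∀ d ∈ v, d ≠ .two) →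
      (D v = true ↔ Q (subteam rows v))) :
    pushTable rows.length D τ = teamTable rows Q τ := by
  unfold teamTable pushTable
  congr 1
  refine List.map_congr_left fun v hv => ?_
  obtain ⟨hl, hd⟩ := mem_idx_replicate.1 hv
  have := h v hl fun d hd' => by
    have := hd d hd'
    rintro rfl
    simp at this
  congr 1
  rw [Bool.eq_iff_iff, this, decide_eq_true_eq]

theorem teamTable_congr {rows : List (ℕ → Bool)} {Q Q' : Set (ℕ → Bool) → Prop}
    (τ : List (Option Bool)) (h : ∀ T, Q T ↔ Q' T) : teamTable rows Q τ = teamTable rows Q' τ := by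
  rw [show Q = Q' from funext fun T => propext (h T)]

theorem column_encodeNat {V : Finset ℕ} {x : ℕ} (hx : x ∈ V) (rows : List (ℕ → Bool)) :
    column V (Computability.encodeNat x) rows = (rows.map fun t => t x).reverse := by
  unfold column
  simp only [lookup_encodeNat _ _ ((Finset.mem_sort _).2 hx)]

theorem forced_reverse {a : List Digit} {cs : List Bool} (h : a.length = cs.length) :
    forced a.reverse cs.reverse = forced a cs := by
  unfold forced
  rw [List.zip_eq_zipWith, List.zip_eq_zipWith, ← List.reverse_zipWith h, List.all_reverse]

/-! ### Effect of the operations on properties of subteams -/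

section

variable (V : Finset ℕ) (rows : List (ℕ → Bool)) (f : List Sym) (τ : List (Option Bool))

theorem forced_column_iff {x : ℕ} (hx : x ∈ V) {v : List Digit} (hl : v.length = rows.length)
    (hv : ∀ d ∈ v, d ≠ .two) :
    forced v.reverse (column V (Computability.encodeNat x) rows) = true ↔
      ∀ t ∈ subteam rows v, t x = true := by
  rw [column_encodeNat hx, forced_reverse (by simpa using hl), forced_iff rows v hv]

theorem forced_not_column_iff {x : ℕ} (hx : x ∈ V) {v : List Digit} (hl : v.length = rows.length)
    (hv : ∀ d ∈ v, d ≠ .two) :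
    forced v.reverse ((column V (Computability.encodeNat x) rows).map not) = true ↔
      ∀ t ∈ subteam rows v, t x = false := by
  rw [column_encodeNat hx, List.map_reverse, List.map_map, forced_reverse (by simpa using hl),
    show (not ∘ fun t : ℕ → Bool => t x) = fun t => !t x from rfl, forced_iff rows v hv]
  simp

/-- A member of the subteam cannot have both values in the column. This works for every column, so
the emptiness test can use the empty name. -/
theorem forced_and_iff (nm : List Bool) {v : List Digit} (hl : v.length = rows.length)
    (hv : ∀ d ∈ v, d ≠ .two) :
    (forced v.reverse (column V nm rows) = true ∧
      forced v.reverse ((column V nm rows).map not) = true) ↔ subteam rows v = ∅ := by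
  unfold column
  rw [List.map_reverse, List.map_map, forced_reverse (by simpa using hl),
    forced_reverse (by simpa using hl), forced_iff rows v hv,
    show (rows.map (not ∘ fun t => lookup nm t false (V.sort (· ≤ ·)))) =
      rows.map fun t => !lookup nm t false (V.sort (· ≤ ·)) from rfl, forced_iff rows v hv,
    Set.eq_empty_iff_forall_notMem]
  constructor
  · rintro ⟨h1, h2⟩ t ht
    have := h1 t ht
    have := h2 t ht
    simp_all
  · intro h
    exact ⟨fun t ht => absurd ht (h t), fun t ht => absurd ht (h t)⟩

theorem passes_lit_column (h : Final) (nm : List Bool) {v : List Digit}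
    (hl : v.length = rows.length) :
    (Op.lit h).passes (column V nm rows) (fun _ => (true, true)) v =
      (forced v.reverse (column V nm rows), forced v.reverse ((column V nm rows).map not)) := by
  have := passes_lit h (column V nm rows) v.reverse [] (by simp [hl, length_column])
    fun _ => (true, true)
  simpa using this

theorem passes_cst_column (h : Final) (nm : List Bool) {v : List Digit}
    (hl : v.length = rows.length) (hv : ∀ d ∈ v, d ≠ .two) (g : List Digit → Bool × Bool) :
    (Op.cst h).passes (column V nm rows) g v =
      ((g v).1 && forced v.reverse (column V nm rows),
        (g v).2 && forced v.reverse ((column V nm rows).map not)) := by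
  have := passes_cst h (column V nm rows) v.reverse [] (by simp [hl, length_column])
    (by simpa using hv) g
  simpa using this

theorem passes_spl_column {x : ℕ} (hx : x ∈ V) {v : List Digit}
    (hl : v.length = rows.length) (hv : ∀ d ∈ v, d ≠ .two) (g : List Digit → Bool × Bool) :
    Op.spl.passes (column V (Computability.encodeNat x) rows) g v =
      ((g (List.zipWith keep v (rows.map fun t => t x))).1,
        (g (List.zipWith keep v (rows.map fun t => !t x))).2) := by
  have := passes_spl (column V (Computability.encodeNat x) rows) v.reverse []
    (by simp [hl, length_column]) (by simpa using hv) g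
  rw [column_encodeNat hx, List.map_reverse, List.map_map,
    ← List.reverse_zipWith (by simpa using hl), ← List.reverse_zipWith (by simpa using hl)] at this
  rw [column_encodeNat hx]
  simpa [Function.comp_def] using this

theorem reach_lit_const (b : Bool) (m : Mode) :
    Reach (opTime (rows.flatMap (encodeAssignment V)).length rows.length 0)
      (some (.look (.lit (if b then .top else .bot)) m false false)) (memory V rows f [] τ)
      (some (.go m)) (memory V rows f [] (teamTable rows (fun _ => b = true) τ)) := by
  refine (reach_lit V rows f τ _ m []).congr ?_
  rw [pushTable_eq_teamTable τ]
  intro v _ _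
  cases b <;> simp [Final.eval]

theorem reach_lit_var (b : Bool) {x : ℕ} (hx : x ∈ V) (m : Mode) :
    Reach (opTime (rows.flatMap (encodeAssignment V)).length rows.length
        (Computability.encodeNat x).length)
      (some (.look (.lit (if b then .fst else .snd)) m false false))
      (memory V rows f (Computability.encodeNat x) τ)
      (some (.go m)) (memory V rows f [] (teamTable rows (fun T => ∀ t ∈ T, t x = b) τ)) := by
  refine (reach_lit V rows f τ _ m _).congr ?_
  rw [pushTable_eq_teamTable τ]
  intro v hl hv
  rw [passes_lit_column V rows _ _ hl]
  cases b
  · exact forced_not_column_iff V rows hx hl hv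
  · exact forced_column_iff V rows hx hl hv

theorem reach_cst_disj {x : ℕ} (hx : x ∈ V) (m : Mode) (Q : Set (ℕ → Bool) → Prop) :
    Reach (opTime (rows.flatMap (encodeAssignment V)).length rows.length
        (Computability.encodeNat x).length)
      (some (.look (.cst .disj) m false false))
      (memory V rows f (Computability.encodeNat x) (teamTable rows Q τ))
      (some (.go m)) (memory V rows f [] (teamTable rows
        (fun T => Q T ∧ ((∀ t ∈ T, t x = true) ∨ ∀ t ∈ T, t x = false)) τ)) := by
  refine (reach_unary V rows f τ (.cst .disj) rfl rfl (by simp) m _ _).congr ?_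
  rw [pushTable_eq_teamTable τ]
  intro v hl hv
  rw [passes_cst_column V rows _ _ hl hv, ← forced_column_iff V rows hx hl hv,
    ← forced_not_column_iff V rows hx hl hv]
  simp [Op.final, Final.eval, and_or_left]

theorem reach_cst_conj (m : Mode) (Q : Set (ℕ → Bool) → Prop) :
    Reach (opTime (rows.flatMap (encodeAssignment V)).length rows.length 0)
      (some (.look (.cst .conj) m false false))
      (memory V rows f [] (teamTable rows Q τ))
      (some (.go m)) (memory V rows f [] (teamTable rows (fun T => Q T ∧ T = ∅) τ)) := by
  refine (reach_unary V rows f τ (.cst .conj) rfl rfl (by simp) m [] _).congr ?_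
  rw [pushTable_eq_teamTable τ]
  intro v hl hv
  rw [passes_cst_column V rows _ _ hl hv, ← forced_and_iff V rows [] hl hv]
  simp [Op.final, Final.eval]
  tauto

theorem reach_spl {x : ℕ} (hx : x ∈ V) (m : Mode) (Q : Set (ℕ → Bool) → Prop) :
    Reach (opTime (rows.flatMap (encodeAssignment V)).length rows.length
        (Computability.encodeNat x).length)
      (some (.look .spl m false false))
      (memory V rows f (Computability.encodeNat x) (teamTable rows Q τ))
      (some (.go m)) (memory V rows f [] (teamTable rows
        (fun T => Q {t ∈ T | t x = true} ∧ Q {t ∈ T | t x = false}) τ)) := by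
  refine (reach_unary V rows f τ .spl rfl rfl (by simp) m _ _).congr ?_
  rw [pushTable_eq_teamTable τ]
  intro v hl hv
  rw [passes_spl_column V rows hx hl hv]
  simp [Op.final, Final.eval, subteam_zipWith_keep rows v fun t => !t x,
    subteam_zipWith_keep rows v fun t => t x]

theorem reach_conj_teamTable (m : Mode) (Q₁ Q₂ : Set (ℕ → Bool) → Prop) :
    Reach (opTime (rows.flatMap (encodeAssignment V)).length rows.length 0)
      (some (.load .conj m))
      (memory V rows f [] (teamTable rows Q₁ (teamTable rows Q₂ τ))) (some (.go m))
      (memory V rows f [] (teamTable rows (fun T => Q₁ T ∧ Q₂ T) τ)) := by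
  refine (reach_conj V rows f τ m _ _ _).congr ?_
  rw [pushTable_eq_teamTable τ]
  intro v _ _
  simp

theorem reach_conv_teamTable (m : Mode) (Q₁ Q₂ : Set (ℕ → Bool) → Prop)
    (h₁ : ∀ S T, S ⊆ T → Q₁ T → Q₁ S) (h₂ : ∀ S T, S ⊆ T → Q₂ T → Q₂ S) :
    Reach (opTime (rows.flatMap (encodeAssignment V)).length rows.length 0)
      (some (.look .conv m false false))
      (memory V rows f [] (teamTable rows Q₁ (teamTable rows Q₂ τ))) (some (.go m))
      (memory V rows f [] (teamTable rows
        (fun T => ∃ T₁ T₂, T₁ ∪ T₂ = T ∧ Q₁ T₁ ∧ Q₂ T₂) τ)) := by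
  refine (reach_conv V rows f τ m _ _).congr ?_
  rw [pushTable_eq_teamTable τ]
  intro v hl hv
  have h := passes_merge (column V [] rows) v.reverse [] (by simp [hl, length_column])
    (by simpa using hv)
  rw [List.append_nil, List.reverse_reverse] at h
  rw [h, ← exists_split_iff rows v hl hv Q₁ Q₂ h₁ h₂]
  -- The passes treat the last row first, so the words of `passes_merge` are the reverses of those
  -- indexed by rows.
  constructor
  · rintro ⟨w, hw, h⟩
    have hlw : w.length = rows.length := by rw [← hl, ← List.length_reverse (as := v), ← hw]; simp
    have h' := passes_conv (column V [] rows) w [] (by simp [hlw, length_column])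
    rw [List.append_nil] at h'
    rw [List.nil_append, h'] at h
    refine ⟨w.reverse, by rw [List.map_reverse, hw, List.reverse_reverse], ?_⟩
    simpa [List.map_reverse] using h
  · rintro ⟨w, rfl, hq⟩
    have h' := passes_conv (column V [] rows) w.reverse [] (by simpa [length_column] using hl)
    rw [List.append_nil] at h'
    refine ⟨w.reverse, List.map_reverse, ?_⟩
    rw [List.nil_append, h']
    simpa [List.map_reverse] using hq

end

/-! ### Evaluation of a formula -/

/-- Downward closure; in the case of a disjunction both parts are intersected with the smaller team.
It is what makes three digits per row enough. -/
theorem Sat.mono {φ : Formula} : ∀ {S T : Set (ℕ → Bool)}, S ⊆ T → Sat T φ → Sat S φ := by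
  induction φ with
  | verum => exact fun _ _ => trivial
  | falsum => exact fun _ h => h
  | var x => exact fun hST h t ht => h t (hST ht)
  | negVar x => exact fun hST h t ht => h t (hST ht)
  | or φ ψ ih₁ ih₂ =>
    rintro S T hST ⟨T₁, T₂, hT, h₁, h₂⟩
    refine ⟨T₁ ∩ S, T₂ ∩ S, ?_, ih₁ Set.inter_subset_left h₁, ih₂ Set.inter_subset_left h₂⟩
    rw [← Set.union_inter_distrib_right, hT, Set.inter_eq_right]
    exact hST
  | and φ ψ ih₁ ih₂ => exact fun hST h => ⟨ih₁ hST h.1, ih₂ hST h.2⟩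
  | dep X Y => exact fun hST h t ht t' ht' => h t (hST ht) t' (hST ht')
  | negDep X Y => exact fun hST h => Set.subset_eq_empty hST h

theorem reach_name (m : Mode) (l : List Bool) (g : List Sym) (s : Mem)
    (hs : s.frm = l.map Sym.bit ++ g) :
    Reach l.length (some (.name m)) s (some (.name m))
      { s with frm := g, nam := l.reverse ++ s.nam } := by
  rcases s with ⟨inp, out, frm, cnt, rev, nam, aux, col, tab, wrk, oa, ob, oc⟩
  dsimp only at hs ⊢
  subst hs
  induction l generalizing nam with
  | nil => exact Reach.refl _ _ _
  | cons b l ih => exact ((ih (b :: nam)).congr (by simp)).head rfl rfl (by simp)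

/-- The bits come off the backwards formula in reverse order, and pushing them onto `nam` restores
the name. -/
theorem reach_encodeVar (m : Mode) (V : Finset ℕ) (rows : List (ℕ → Bool)) (x : ℕ) (g : List Sym)
    (τ : List (Option Bool)) :
    Reach ((Computability.encodeNat x).length + 1) (some (.go m))
      (memory V rows ((encodeVar x).reverse ++ g) [] τ) (some (.name m))
      (memory V rows g (Computability.encodeNat x) τ) := by
  have h := reach_name m (Computability.encodeNat x).reverse g
    (memory V rows ((Computability.encodeNat x).reverse.map Sym.bit ++ g) [] τ) rfl
  refine Reach.head (h.congr (by simp)) ?_ ?_ (by simp)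
  · cases m <;> simp [encodeVar] <;> rfl
  · cases m <;> simp [encodeVar] <;> rfl

theorem reach_name_exit (m : Mode) (V : Finset ℕ) (rows : List (ℕ → Bool)) (a : Sym)
    (ha : ∀ b, a ≠ .bit b) (g : List Sym) (nm : List Bool) (τ : List (Option Bool)) :
    Reach 1 (some (.name m)) (memory V rows (a :: g) nm τ)
      (match m with
        | .expr => some (.go .expr)
        | .snd => some (.look (.cst .disj) .snd false false)
        | .fst => some (.look .spl .fst false false))
      (memory V rows (a :: g) nm τ) := by
  cases a
  case bit b => exact absurd rfl (ha b)
  all_goals cases m <;> exact (Reach.refl 0 _ _).head rfl rfl (le_refl _)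

/-- Reading a name stops at the first symbol that is not a bit: the separator of the preceding
variable or, at the start of the list, the symbol `a`. -/
theorem exists_reverse_flatMap_encodeVar (l : List ℕ) (a : Sym) (ha : ∀ b, a ≠ .bit b)
    (g : List Sym) : ∃ a' g', (∀ b, a' ≠ Sym.bit b) ∧
      (l.flatMap encodeVar).reverse ++ a :: g = a' :: g' := by
  rcases l.eq_nil_or_concat with rfl | ⟨l, x, rfl⟩
  · exact ⟨a, g, ha, rfl⟩
  · exact ⟨.sep, _, by simp, by simp [encodeVar]; rfl⟩

/-- Fixing the values on `l` and then that of `x` is the same as fixing them on `l ++ [x]`; since `x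
∉ l`, changing `a` at `x` does not disturb the first choice. -/
theorem filter_agree_iff {Q : Set (ℕ → Bool) → Prop} {l : List ℕ} {x : ℕ} (hx : x ∉ l)
    (T : Set (ℕ → Bool)) :
    (∀ a : ℕ → Bool, Q {t ∈ {t ∈ T | ∀ p ∈ l, t p = a p} | t x = true} ∧
      Q {t ∈ {t ∈ T | ∀ p ∈ l, t p = a p} | t x = false}) ↔
    ∀ a : ℕ → Bool, Q {t ∈ T | ∀ p ∈ l ++ [x], t p = a p} := by
  have key : ∀ (a a' : ℕ → Bool) (b : Bool), a' x = b → (∀ p ∈ l, a' p = a p) →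
      {t ∈ {t ∈ T | ∀ p ∈ l, t p = a p} | t x = b} = {t ∈ T | ∀ p ∈ l ++ [x], t p = a' p} := by
    intro a a' b hb h
    ext t
    simp only [Set.mem_ofPred_eq, List.mem_append, List.mem_singleton, and_assoc]
    refine and_congr_right fun _ => ⟨?_, ?_⟩
    · rintro ⟨h1, h2⟩ p (hp | rfl)
      · rw [h1 p hp, h p hp]
      · rw [h2, hb]
    · intro h1
      exact ⟨fun p hp => by rw [h1 p (.inl hp), h p hp], by rw [h1 x (.inr rfl), hb]⟩
  constructor
  · intro H a
    cases hb : a x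
    · rw [← key a a false hb fun _ _ => rfl]; exact (H a).2
    · rw [← key a a true hb fun _ _ => rfl]; exact (H a).1
  · intro H a
    have hu : ∀ b, ∀ p ∈ l, Function.update a x b p = a p := fun b p hp =>
      Function.update_of_ne (by rintro rfl; exact hx hp) _ _
    exact ⟨by rw [key a _ true (Function.update_self ..) (hu true)]; exact H _,
      by rw [key a _ false (Function.update_self ..) (hu false)]; exact H _⟩

section

-- `B` covers one table operation together with a few control steps; each symbol of the formula is
-- charged at most `B`.
variable {V : Finset ℕ} {rows : List (ℕ → Bool)} {B : ℕ}
  (hB₀ : opTime (rows.flatMap (encodeAssignment V)).length rows.length 0 + 2 ≤ B)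
  (hB : ∀ x ∈ V, opTime (rows.flatMap (encodeAssignment V)).length rows.length
    (Computability.encodeNat x).length + 2 ≤ B)
include hB

theorem reach_snd (l : List ℕ) (hl : ∀ x ∈ l, x ∈ V) (g : List Sym)
    (Q : Set (ℕ → Bool) → Prop) (τ : List (Option Bool)) :
    Reach (B * (l.flatMap encodeVar).length) (some (.go .snd))
      (memory V rows ((l.flatMap encodeVar).reverse ++ Sym.close :: g) [] (teamTable rows Q τ))
      (some (.go .snd))
      (memory V rows (Sym.close :: g) [] (teamTable rows
        (fun T => Q T ∧ ∀ y ∈ l, (∀ t ∈ T, t y = true) ∨ ∀ t ∈ T, t y = false) τ)) := by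
  induction l using List.reverseRecOn generalizing Q with
  | nil => exact (Reach.refl _ _ _).congr (by rw [teamTable_congr τ (Q' := Q)] <;> simp)
  | append_singleton l x ih =>
    have hx := hl x (by simp)
    obtain ⟨a, g', ha, e⟩ := exists_reverse_flatMap_encodeVar l .close (by simp) g
    have h1 := reach_encodeVar .snd V rows x (a :: g') (teamTable rows Q τ)
    have h2 := (h1.trans (reach_name_exit .snd V rows a ha g' _ _)).trans
      (reach_cst_disj V rows (a :: g') τ hx .snd Q)
    rw [← e] at h2
    have h3 := h2.trans (ih (fun y hy => hl y (by simp [hy])) _)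
    rw [List.flatMap_append, List.reverse_append, List.append_assoc]
    simp only [List.flatMap_cons, List.flatMap_nil, List.append_nil]
    refine (h3.congr ?_).mono ?_
    · rw [teamTable_congr τ]
      intro T
      simp only [List.mem_append, List.mem_singleton, or_imp, forall_and, forall_eq]
      tauto
    · have := hB x hx
      rw [List.length_append, Nat.mul_add]
      simp only [encodeVar, List.length_append, List.length_map, List.length_singleton]
      nlinarith

theorem reach_fst (l : List ℕ) (hl : ∀ x ∈ l, x ∈ V) (hn : l.Nodup) (a : Sym)
    (ha : ∀ b, a ≠ .bit b) (g : List Sym) (Q : Set (ℕ → Bool) → Prop) (τ : List (Option Bool)) :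
    Reach (B * (l.flatMap encodeVar).length) (some (.go .fst))
      (memory V rows ((l.flatMap encodeVar).reverse ++ a :: g) [] (teamTable rows Q τ))
      (some (.go .fst))
      (memory V rows (a :: g) [] (teamTable rows
        (fun T => ∀ c : ℕ → Bool, Q {t ∈ T | ∀ p ∈ l, t p = c p}) τ)) := by
  induction l using List.reverseRecOn generalizing Q with
  | nil => exact (Reach.refl _ _ _).congr (by rw [teamTable_congr τ (Q' := Q)] <;> simp)
  | append_singleton l x ih =>
    have hx := hl x (by simp)
    have hxl : x ∉ l := fun h => (List.nodup_append.1 hn).2.2 x h x (by simp) rfl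
    obtain ⟨a', g', ha', e⟩ := exists_reverse_flatMap_encodeVar l a ha g
    have h1 := reach_encodeVar .fst V rows x (a' :: g') (teamTable rows Q τ)
    have h2 := (h1.trans (reach_name_exit .fst V rows a' ha' g' _ _)).trans
      (reach_spl V rows (a' :: g') τ hx .fst Q)
    rw [← e] at h2
    have h3 := h2.trans (ih (fun y hy => hl y (by simp [hy])) (List.nodup_append.1 hn).1 _)
    rw [List.flatMap_append, List.reverse_append, List.append_assoc]
    simp only [List.flatMap_cons, List.flatMap_nil, List.append_nil]
    refine (h3.congr ?_).mono ?_
    · rw [teamTable_congr τ]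
      exact filter_agree_iff hxl
    · have := hB x hx
      rw [List.length_append, Nat.mul_add]
      simp only [encodeVar, List.length_append, List.length_map, List.length_singleton]
      nlinarith

theorem reach_literal (b : Bool) {x : ℕ} (hx : x ∈ V) (g : List Sym) (τ : List (Option Bool)) :
    Reach (B * ((encodeVar x).length + 1)) (some (.go .expr))
      (memory V rows ((encodeVar x).reverse ++ (if b then Sym.pos else Sym.neg) :: g) [] τ)
      (some (.go .expr)) (memory V rows g [] (teamTable rows (fun T => ∀ t ∈ T, t x = b) τ)) := by
  have h1 := (reach_encodeVar .expr V rows x ((if b then Sym.pos else Sym.neg) :: g) τ).trans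
    (reach_name_exit .expr V rows _ (by cases b <;> simp) g _ τ)
  have h2 := h1.trans (Reach.head (reach_lit_var V rows g τ b hx .expr)
    (by cases b <;> rfl) (by cases b <;> rfl) (le_refl _))
  refine h2.mono ?_
  have := hB x hx
  simp only [encodeVar, List.length_append, List.length_map, List.length_singleton]
  nlinarith

include hB₀

/-- Read backwards, the atom yields constancy of each variable of `Y` first and the case
distinctions over `X` afterwards, so constancy is required within each class of `X`. -/
theorem reach_dependence (X Y : Finset ℕ) (hX : X ⊆ V) (hY : Y ⊆ V) (a : Sym)
    (ha : ∀ b, a ≠ .bit b) (g : List Sym) (τ : List (Option Bool)) :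
    Reach (B * (encodeVars X ++ encodeVars Y).length) (some (.go .expr))
      (memory V rows ((encodeVars X ++ encodeVars Y).reverse ++ a :: g) [] τ)
      (some (.go .fst))
      (memory V rows (a :: g) [] (teamTable rows (fun T => Sat T (.dep X Y)) τ)) := by
  have hs : ∀ {Z : Finset ℕ}, Z ⊆ V → ∀ x ∈ Z.sort (· ≤ ·), x ∈ V := fun h x hx =>
    h ((Finset.mem_sort _).1 hx)
  have h1 : Reach (opTime (rows.flatMap (encodeAssignment V)).length rows.length 0 + 1)
      (some (.go .expr))
      (memory V rows ((encodeVars X ++ encodeVars Y).reverse ++ a :: g) [] τ) (some (.go .snd)) _ :=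
    Reach.head (reach_lit_const V rows (((Y.sort (· ≤ ·)).flatMap encodeVar).reverse ++
      Sym.close :: (((X.sort (· ≤ ·)).flatMap encodeVar).reverse ++ a :: g)) τ true .snd)
      (by simp [encodeVars]; rfl) (by simp [encodeVars]; rfl) (le_refl _)
  have h2 := h1.trans (reach_snd hB (Y.sort (· ≤ ·)) (hs hY) _ _ τ)
  have h3 := h2.trans (Reach.head (reach_fst hB (X.sort (· ≤ ·)) (hs hX) (Finset.sort_nodup _ _)
    a ha g (fun T => true = true ∧ ∀ y ∈ Y.sort (· ≤ ·),
      (∀ t ∈ T, t y = true) ∨ ∀ t ∈ T, t y = false) τ) rfl rfl (le_refl _))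
  refine (h3.congr ?_).mono ?_
  · rw [teamTable_congr τ]
    intro T
    simp only [Finset.mem_sort, true_and, Set.mem_ofPred_eq, Sat]
    constructor
    -- Apply the hypothesis to the class of `t'`, which also contains `t`.
    · intro H t ht t' ht' hX q hq
      rcases H t' q hq with h | h <;>
        rw [h t ⟨ht, hX⟩, h t' ⟨ht', fun _ _ => rfl⟩]
    · intro H c q hq
      by_contra! hn
      obtain ⟨⟨t, ht, hq1⟩, t', ht', hq2⟩ := hn
      have := H t ht.1 t' ht'.1 (fun p hp => by rw [ht.2 p hp, ht'.2 p hp]) q hq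
      simp_all
  · simp only [encodeVars, List.length_append, List.length_singleton]
    nlinarith

/-- Prefix notation read backwards is evaluated with a stack of tables. The right operand comes
first, so the table of the left one ends on top. -/
theorem reach_formula (φ : Formula) (hφ : φ.vars ⊆ V) (g : List Sym) (τ : List (Option Bool)) :
    Reach (B * φ.encode.length) (some (.go .expr))
      (memory V rows (φ.encode.reverse ++ g) [] τ) (some (.go .expr))
      (memory V rows g [] (teamTable rows (fun T => Sat T φ) τ)) := by
  induction φ generalizing g τ with
  | verum =>
    refine Reach.head ((reach_lit_const V rows g τ true .expr).congr ?_) rfl rfl ?_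
    · rw [teamTable_congr τ]; simp [Sat]
    · simp only [Formula.encode, List.length_singleton]; omega
  | falsum =>
    refine Reach.head ((reach_lit_const V rows g τ false .expr).congr ?_) rfl rfl ?_
    · rw [teamTable_congr τ]; simp [Sat]
    · simp only [Formula.encode, List.length_singleton]; omega
  | var x =>
    have := reach_literal hB true (hφ (by simp [Formula.vars]) : x ∈ V) g τ
    simpa [Formula.encode, Sat] using this
  | negVar x =>
    have := reach_literal hB false (hφ (by simp [Formula.vars]) : x ∈ V) g τ
    simpa [Formula.encode, Sat] using this
  | or φ ψ ih₁ ih₂ =>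
    simp only [Formula.vars, Finset.union_subset_iff] at hφ
    simp only [Formula.encode, List.reverse_cons, List.reverse_append, List.append_assoc,
      List.singleton_append]
    have h := (ih₂ hφ.2 _ τ).trans (ih₁ hφ.1 (Sym.or :: g) _)
    refine (h.trans (Reach.head (reach_conv_teamTable V rows g τ .expr _ _
      (fun _ _ => Sat.mono) (fun _ _ => Sat.mono)) rfl rfl (le_refl _))).mono ?_
    simp only [List.length_cons, List.length_append]
    nlinarith
  | and φ ψ ih₁ ih₂ =>
    simp only [Formula.vars, Finset.union_subset_iff] at hφ
    simp only [Formula.encode, List.reverse_cons, List.reverse_append, List.append_assoc,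
      List.singleton_append]
    have h := (ih₂ hφ.2 _ τ).trans (ih₁ hφ.1 (Sym.and :: g) _)
    refine (h.trans (Reach.head (reach_conj_teamTable V rows g τ .expr _ _)
      rfl rfl (le_refl _))).mono ?_
    simp only [List.length_cons, List.length_append]
    nlinarith
  | dep X Y =>
    simp only [Formula.vars, Finset.union_subset_iff] at hφ
    simp only [Formula.encode, List.reverse_cons, List.append_assoc, List.singleton_append]
    have h := reach_dependence hB₀ hB X Y hφ.1 hφ.2 .dep (by simp) g τ
    refine (h.trans (Reach.head (Reach.refl 0 _ _) rfl rfl (le_refl _))).mono ?_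
    rw [List.length_cons, Nat.mul_add]
    omega
  | negDep X Y =>
    simp only [Formula.vars, Finset.union_subset_iff] at hφ
    simp only [Formula.encode, List.reverse_cons, List.append_assoc, List.singleton_append]
    have h := reach_dependence hB₀ hB X Y hφ.1 hφ.2 .negDep (by simp) g τ
    refine ((h.trans (Reach.head (reach_cst_conj V rows g τ .expr
      fun T => Sat T (.dep X Y)) rfl rfl (le_refl _))).congr
      ?_).mono ?_
    · rw [teamTable_congr τ]
      intro T
      -- The machine has also tested `dep X Y`, but the empty team satisfies it, so only emptiness
      -- remains.
      simp only [Sat, and_iff_right_iff_imp]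
      rintro rfl
      simp
    · rw [List.length_cons, Nat.mul_add]
      omega

end

/-! ### The whole computation -/

theorem reach_copyVar (l : List Bool) (R : List Sym) (s : Mem)
    (hs : s.inp = l.map Sym.bit ++ Sym.sep :: R) :
    Reach (l.length + 1) (some .copyVar) s (some .scan)
      { s with inp := R, frm := (l.map Sym.bit ++ [Sym.sep]).reverse ++ s.frm } := by
  rcases s with ⟨inp, out, frm, cnt, rev, nam, aux, col, tab, wrk, oa, ob, oc⟩
  dsimp only at hs ⊢
  subst hs
  induction l generalizing frm with
  | nil => exact (Reach.refl 0 _ _).head rfl rfl (by simp)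
  | cons b l ih => exact ((ih (Sym.bit b :: frm)).congr (by simp)).head rfl rfl (by simp)

theorem reach_copyVars (l R : List Sym) (hl : Sym.close ∉ l) (s : Mem)
    (hs : s.inp = l ++ Sym.close :: R) :
    Reach (l.length + 1) (some .copyVars) s (some .copyVars')
      { s with inp := R, frm := (l ++ [Sym.close]).reverse ++ s.frm } := by
  rcases s with ⟨inp, out, frm, cnt, rev, nam, aux, col, tab, wrk, oa, ob, oc⟩
  dsimp only at hs ⊢
  subst hs
  induction l generalizing frm with
  | nil => exact (Reach.refl 0 _ _).head rfl rfl (by simp)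
  | cons a l ih =>
    have h := ih (fun h => hl (by simp [h])) (a :: frm)
    cases a
    case close => simp at hl
    all_goals exact (h.congr (by simp)).head rfl rfl (by simp)

theorem reach_copyVars' (l R : List Sym) (hl : Sym.close ∉ l) (s : Mem)
    (hs : s.inp = l ++ Sym.close :: R) :
    Reach (l.length + 1) (some .copyVars') s (some .scan)
      { s with inp := R, frm := (l ++ [Sym.close]).reverse ++ s.frm } := by
  rcases s with ⟨inp, out, frm, cnt, rev, nam, aux, col, tab, wrk, oa, ob, oc⟩
  dsimp only at hs ⊢
  subst hs
  induction l generalizing frm with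
  | nil => exact (Reach.refl 0 _ _).head rfl rfl (by simp)
  | cons a l ih =>
    have h := ih (fun h => hl (by simp [h])) (a :: frm)
    cases a
    case close => simp at hl
    all_goals exact (h.congr (by simp)).head rfl rfl (by simp)

theorem close_notMem_flatMap_encodeVar (l : List ℕ) : Sym.close ∉ l.flatMap encodeVar := by
  simp [encodeVar]

/-- One mark of `cnt` is spent per complete subformula, so the scan stops exactly at the end of the
formula and leaves the rows on `inp`. -/
theorem reach_scan (φ : Formula) (R : List Sym) (c : List Unit) (s : Mem)
    (hs : s.inp = φ.encode ++ R) (hc : s.cnt = () :: c) :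
    Reach φ.encode.length (some .scan) s (some .scan)
      { s with inp := R, cnt := c, frm := φ.encode.reverse ++ s.frm } := by
  induction φ generalizing R c s with
  | or φ ψ ih₁ ih₂ =>
    rcases s with ⟨inp, out, frm, cnt, rev, nam, aux, col, tab, wrk, oa, ob, oc⟩
    dsimp only at hs hc
    subst hs hc
    have h := (ih₁ (ψ.encode ++ R) (() :: c) ⟨φ.encode ++ (ψ.encode ++ R), out, Sym.or :: frm,
      () :: () :: c, rev, nam, aux, col, tab, wrk, oa, ob, oc⟩ rfl rfl).trans (ih₂ R c _ rfl rfl)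
    exact (h.congr (by simp [Formula.encode])).head rfl (by simp [Formula.encode]; rfl)
      (by simp [Formula.encode])
  | and φ ψ ih₁ ih₂ =>
    rcases s with ⟨inp, out, frm, cnt, rev, nam, aux, col, tab, wrk, oa, ob, oc⟩
    dsimp only at hs hc
    subst hs hc
    have h := (ih₁ (ψ.encode ++ R) (() :: c) ⟨φ.encode ++ (ψ.encode ++ R), out, Sym.and :: frm,
      () :: () :: c, rev, nam, aux, col, tab, wrk, oa, ob, oc⟩ rfl rfl).trans (ih₂ R c _ rfl rfl)
    exact (h.congr (by simp [Formula.encode])).head rfl (by simp [Formula.encode]; rfl)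
      (by simp [Formula.encode])
  | dep X Y =>
    rcases s with ⟨inp, out, frm, cnt, rev, nam, aux, col, tab, wrk, oa, ob, oc⟩
    dsimp only at hs hc
    subst hs hc
    have h := (reach_copyVars _ (encodeVars Y ++ R)
      (close_notMem_flatMap_encodeVar (X.sort (· ≤ ·))) ⟨_, out, Sym.dep :: frm, c, rev, nam, aux,
        col, tab, wrk, oa, ob, oc⟩ rfl).trans (reach_copyVars' _ R
      (close_notMem_flatMap_encodeVar (Y.sort (· ≤ ·))) _ (by simp [encodeVars]))
    exact (h.congr (by simp [Formula.encode, encodeVars])).head rfl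
      (by simp [Formula.encode, encodeVars]; rfl)
      (by simp +arith [Formula.encode, encodeVars])
  | negDep X Y =>
    rcases s with ⟨inp, out, frm, cnt, rev, nam, aux, col, tab, wrk, oa, ob, oc⟩
    dsimp only at hs hc
    subst hs hc
    have h := (reach_copyVars _ (encodeVars Y ++ R)
      (close_notMem_flatMap_encodeVar (X.sort (· ≤ ·))) ⟨_, out, Sym.negDep :: frm, c, rev, nam,
        aux, col, tab, wrk, oa, ob, oc⟩ rfl).trans (reach_copyVars' _ R
      (close_notMem_flatMap_encodeVar (Y.sort (· ≤ ·))) _ (by simp [encodeVars]))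
    exact (h.congr (by simp [Formula.encode, encodeVars])).head rfl
      (by simp [Formula.encode, encodeVars]; rfl)
      (by simp +arith [Formula.encode, encodeVars])
  | var x =>
    rcases s with ⟨inp, out, frm, cnt, rev, nam, aux, col, tab, wrk, oa, ob, oc⟩
    dsimp only at hs hc
    subst hs hc
    have h := reach_copyVar (Computability.encodeNat x) R ⟨_, out, Sym.pos :: frm, c, rev, nam, aux,
        col, tab, wrk, oa, ob, oc⟩ rfl
    exact (h.congr (by simp [Formula.encode, encodeVar])).head rfl
      (by simp [Formula.encode, encodeVar]; rfl) (by simp [Formula.encode, encodeVar])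
  | negVar x =>
    rcases s with ⟨inp, out, frm, cnt, rev, nam, aux, col, tab, wrk, oa, ob, oc⟩
    dsimp only at hs hc
    subst hs hc
    have h := reach_copyVar (Computability.encodeNat x) R ⟨_, out, Sym.neg :: frm, c, rev, nam, aux,
        col, tab, wrk, oa, ob, oc⟩ rfl
    exact (h.congr (by simp [Formula.encode, encodeVar])).head rfl
      (by simp [Formula.encode, encodeVar]; rfl) (by simp [Formula.encode, encodeVar])
  | _ =>
    rcases s with ⟨inp, out, frm, cnt, rev, nam, aux, col, tab, wrk, oa, ob, oc⟩
    dsimp only at hs hc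
    subst hs hc
    exact (Reach.refl 0 _ _).head rfl rfl (le_refl _)

theorem reach_answer (b : Bool) (l : List Bool) (s : Mem) (hs : s.tab = l.map some ++ [none]) :
    Reach (l.length + 2) (some (.answer b)) s (some (.erase (l.getLastD b)))
      { s with tab := [] } := by
  rcases s with ⟨inp, out, frm, cnt, rev, nam, aux, col, tab, wrk, oa, ob, oc⟩
  dsimp only at hs ⊢
  subst hs
  induction l generalizing b with
  | nil =>
    refine Reach.head ?_ rfl rfl (le_refl _)
    exact (Reach.refl 0 _ _).head rfl rfl (by simp)
  | cons c l ih =>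
    rw [List.getLastD_cons]
    exact (ih c).head rfl rfl (by simp)

theorem reach_erase (b : Bool) (s : Mem) :
    Reach (s.inp.length + 1) (some (.erase b)) s none { s with inp := [], out := b :: s.out } := by
  rcases s with ⟨inp, out, frm, cnt, rev, nam, aux, col, tab, wrk, oa, ob, oc⟩
  dsimp only
  induction inp with
  | nil => exact (Reach.refl 0 _ _).head rfl rfl (by simp)
  | cons a l ih => exact (ih.congr (by simp)).head rfl rfl (by simp)

/-- The full team has the last index in lexicographic order, so the last bit of the final table is
the answer. -/
theorem idx_binary_eq_append (k : ℕ) :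
    ∃ l, idx (List.replicate k [.zero, .one]) = l ++ [List.replicate k .one] := by
  induction k with
  | zero => exact ⟨[], rfl⟩
  | succ k ih =>
    obtain ⟨l, hl⟩ := ih
    refine ⟨(l ++ [List.replicate k Digit.one]).map (Digit.zero :: ·) ++ l.map (Digit.one :: ·), ?_⟩
    simp [List.replicate_succ, idx, hl]

theorem subteam_replicate_one (rows : List (ℕ → Bool)) :
    subteam rows (List.replicate rows.length .one) = {t | t ∈ rows} := by
  ext t
  induction rows with
  | nil => simp [subteam]
  | cons s rows ih =>
    simp only [subteam, Set.mem_ofPred_eq] at ih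
    simp [subteam, List.replicate_succ, ih]

open Classical in
theorem reach_halt (I : MCInstance) {B : ℕ}
    (hB : ∀ n ≤ I.formula.size,
      opTime (I.rows.flatMap (encodeAssignment I.formula.vars)).length I.rows.length n + 2 ≤ B)
    (hv : ∀ x ∈ I.formula.vars, (Computability.encodeNat x).length ≤ I.formula.size) :
    Reach (I.formula.size + B * I.formula.size + 3 ^ I.rows.length +
        (I.rows.flatMap (encodeAssignment I.formula.vars)).length + 6)
      (some .start) { inp := I.encode } none { out := [decide (Sat I.team I.formula)] } := by
  set R := I.rows.flatMap (encodeAssignment I.formula.vars) with hR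
  have h1 : Reach (I.formula.size + 1) (some .start) { inp := I.encode } (some .scan)
      { inp := R, frm := I.formula.encode.reverse } :=
    ((reach_scan I.formula R [] { inp := I.encode, cnt := [()] } rfl rfl).congr (by simp)).head
      rfl rfl (le_refl _)
  have h2 : Reach (I.formula.size + 1 + 1) (some .start) { inp := I.encode } (some (.go .expr))
      (memory I.formula.vars I.rows (I.formula.encode.reverse ++ []) [] []) :=
    h1.trans ((Reach.refl 0 _ _).head rfl (by simp; rfl) (le_refl _))
  have h3 := h2.trans (reach_formula (hB 0 (Nat.zero_le _)) (fun x hx => hB _ (hv x hx))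
    I.formula subset_rfl [] [])
  have h4 := h3.trans (Reach.head (reach_answer false ((idx (List.replicate I.rows.length
    [.zero, .one])).map fun v => decide (Sat (subteam I.rows v) I.formula))
      (memory I.formula.vars I.rows [] [] (teamTable I.rows (fun T => Sat T I.formula) []))
      (by simp [teamTable, pushTable])) rfl rfl (le_refl _))
  have h5 := h4.trans (reach_erase _ _)
  obtain ⟨l, hl⟩ := idx_binary_eq_append I.rows.length
  have h6 := length_idx_replicate_le I.rows.length (d := [.zero, .one]) (by simp)
  refine (h5.congr ?_).mono ?_
  · have : subteam I.rows (List.replicate I.rows.length .one) = I.team := subteam_replicate_one _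
    simp [hl, this]
  · simp only [List.length_map, Formula.size, ← hR]
    omega

/-! ### Lengths of encodings and the time bound -/

theorem sum_encodeVar_vars_le (φ : Formula) :
    ∑ x ∈ φ.vars, (encodeVar x).length ≤ φ.size := by
  have hs : ∀ X : Finset ℕ, ∑ x ∈ X, (encodeVar x).length ≤ (encodeVars X).length := by
    intro X
    rw [encodeVars, List.length_append, List.length_flatMap]
    conv_lhs => rw [← Finset.sort_toFinset X (· ≤ ·),
      List.sum_toFinset _ (Finset.sort_nodup X (· ≤ ·))]
    exact Nat.le_add_right _ _
  have hu : ∀ X Y : Finset ℕ, ∑ x ∈ X ∪ Y, (encodeVar x).length ≤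
      ∑ x ∈ X, (encodeVar x).length + ∑ x ∈ Y, (encodeVar x).length := fun X Y => by
    rw [← Finset.sum_union_inter]; exact Nat.le_add_right _ _
  unfold Formula.size
  induction φ with
  | verum => simp [Formula.vars]
  | falsum => simp [Formula.vars]
  | var x => simp [Formula.vars, Formula.encode]
  | negVar x => simp [Formula.vars, Formula.encode]
  | or φ ψ ih₁ ih₂ =>
    refine (hu _ _).trans ?_
    simp only [Formula.encode, List.length_cons, List.length_append]
    omega
  | and φ ψ ih₁ ih₂ =>
    refine (hu _ _).trans ?_
    simp only [Formula.encode, List.length_cons, List.length_append]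
    omega
  | dep X Y =>
    refine (hu _ _).trans ?_
    have := hs X
    have := hs Y
    simp only [Formula.encode, List.length_cons, List.length_append]
    omega
  | negDep X Y =>
    refine (hu _ _).trans ?_
    have := hs X
    have := hs Y
    simp only [Formula.encode, List.length_cons, List.length_append]
    omega

theorem length_encodeNat_le_size {φ : Formula} {x : ℕ} (hx : x ∈ φ.vars) :
    (Computability.encodeNat x).length ≤ φ.size := by
  refine le_trans ?_ (sum_encodeVar_vars_le φ)
  refine le_trans ?_ (Finset.single_le_sum (fun y _ => Nat.zero_le (encodeVar y).length) hx)
  simp [encodeVar]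

/-- The value bit of a variable is no longer than its name with the separator, hence the factor two;
the extra one is the closing symbol. -/
theorem length_encodeAssignment_le (φ : Formula) (t : ℕ → Bool) :
    (encodeAssignment φ.vars t).length ≤ 2 * φ.size + 1 := by
  have h : ∑ x ∈ φ.vars, (encodeVar x ++ [Sym.bit (t x)]).length ≤
      ∑ x ∈ φ.vars, 2 * (encodeVar x).length :=
    Finset.sum_le_sum fun x _ => by simp [encodeVar]; omega
  rw [← Finset.mul_sum] at h
  have h' := sum_encodeVar_vars_le φ
  rw [encodeAssignment, List.length_append, List.length_flatMap, List.length_singleton,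
    ← List.sum_toFinset _ (Finset.sort_nodup _ (· ≤ ·)), Finset.sort_toFinset]
  omega

theorem length_rows_le (φ : Formula) (rows : List (ℕ → Bool)) :
    (rows.flatMap (encodeAssignment φ.vars)).length ≤ rows.length * (2 * φ.size + 1) := by
  induction rows with
  | nil => simp
  | cons t rows ih =>
    rw [List.flatMap_cons, List.length_append, List.length_cons, Nat.add_one_mul rows.length]
    have := length_encodeAssignment_le φ t
    omega

theorem add_three_mul_three_pow_le (k : ℕ) : (k + 3) * 3 ^ k ≤ 3 * 4 ^ k := by
  induction k with
  | zero => simp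
  | succ k ih =>
    rw [pow_succ, pow_succ]
    -- The inductive step reduces to `3 * (k + 4) ≤ 4 * (k + 3)`, which explains the shift by three.
    nlinarith [Nat.zero_le (k * 3 ^ k)]

/-- The constant is `16 + 120 + 2`: the row scans, the passes with `(k + 1) * 3 ^ k ≤ 3 * 4 ^ k`,
and the two control steps. -/
theorem opTime_le {R k n s : ℕ} (hR : R ≤ k * (2 * s + 1)) (hn : n ≤ s) :
    opTime R k n + 2 ≤ 138 * (4 ^ k * (s + 1) ^ 2) := by
  have h1 : k + 1 ≤ 4 ^ k := Nat.lt_pow_self (by norm_num)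
  have h2 := add_three_mul_three_pow_le k
  have h3 : R + 1 ≤ 4 ^ k * (2 * s + 1) :=
    le_trans (by nlinarith) (Nat.mul_le_mul_right (2 * s + 1) h1)
  have h4 : (R + 1) * (n + 1) ≤ 4 ^ k * (2 * s + 1) * (s + 1) :=
    Nat.mul_le_mul h3 (by omega)
  have h5 : 4 ^ k ≤ 4 ^ k * (s + 1) ^ 2 := Nat.le_mul_of_pos_right _ (by positivity)
  unfold opTime
  nlinarith [Nat.zero_le (4 ^ k * s), Nat.zero_le (4 ^ k * s ^ 2)]

theorem MCInstance.teamSize_eq (I : MCInstance) : I.teamSize = I.rows.length := by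
  classical
  have : I.team = (I.rows.toFinset : Set (ℕ → Bool)) := by ext; simp [MCInstance.team]
  rw [MCInstance.teamSize, this, Set.ncard_coe_finset, List.toFinset_card_of_nodup I.rows_nodup]

open Classical in
theorem reach_halt_time (I : MCInstance) :
    Reach (200 * (2 ^ (2 * I.teamSize) * (I.formula.size + 1) ^ 3))
      (some .start) { inp := I.encode } none { out := [decide (Sat I.team I.formula)] } := by
  have hR := length_rows_le I.formula I.rows
  refine (reach_halt I (fun n hn => opTime_le hR hn)
    fun x hx => length_encodeNat_le_size hx).mono ?_
  rw [I.teamSize_eq, pow_mul, show 2 ^ 2 = 4 by norm_num]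
  have h1 : I.rows.length + 1 ≤ 4 ^ I.rows.length := Nat.lt_pow_self (by norm_num)
  have h2 : 3 ^ I.rows.length ≤ 4 ^ I.rows.length := Nat.pow_le_pow_left (by norm_num) _
  generalize 4 ^ I.rows.length = E at *
  generalize I.formula.size = n at *
  have h3 : (I.rows.flatMap (encodeAssignment I.formula.vars)).length ≤ E * (2 * n + 1) :=
    hR.trans (Nat.mul_le_mul_right _ (by omega))
  have h4 : 1 ≤ E := by omega
  have h5 : n ≤ E * n := Nat.le_mul_of_pos_left _ h4
  nlinarith [Nat.zero_le (E * n), Nat.zero_le (E * n ^ 2), Nat.zero_le (E * n ^ 3)]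

/-- The Turing machine for model checking. -/
noncomputable def checker : Turing.TM2ComputableAux Sym Bool where
  tm := toFinTM2 machine Stk.inp Stk.out Label.start
  inputAlphabet := Equiv.refl Sym
  outputAlphabet := Equiv.refl Bool

open Classical in
theorem decidedBy_checker {t : MCInstance → ℕ}
    (ht : ∀ I : MCInstance, 200 * (2 ^ (2 * I.teamSize) * (I.formula.size + 1) ^ 3) ≤ t I) :
    mcTeamSize.DecidedBy checker t := by
  refine ⟨fun k => finite_alph k, fun I => ?_⟩
  obtain ⟨m, hm, e⟩ := Run.evals (k₀ := Stk.inp) (k₁ := Stk.out) (main := Label.start)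
    (reach_halt_time I) rfl (fun _ => none) (fun _ => rfl)
  refine ⟨⟨⟨m, ?_⟩, hm.trans (ht I)⟩⟩
  have h1 : Turing.initList checker.tm
      (((mcTeamSize.encode I).map checker.inputAlphabet.symm)) =
      (⟨some .start, fun _ => none, Mem.get { inp := I.encode }⟩ :
        Turing.TM2.Cfg Alph Label (∀ k, Option (Alph k))) := by
    unfold Turing.initList
    congr 1
    funext k
    cases k
    case inp => exact List.map_id _
    all_goals rfl
  have h2 : Turing.haltList checker.tm
      ((Computability.encodeBool (decide (mcTeamSize.Yes I))).map checker.outputAlphabet.symm) =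
      (⟨none, fun _ => none, Mem.get { out := [decide (Sat I.team I.formula)] }⟩ :
        Turing.TM2.Cfg Alph Label (∀ k, Option (Alph k))) := by
    unfold Turing.haltList
    congr 1
    funext k
    cases k <;> rfl
  exact ((congrArg (fun c => (flip bind checker.tm.step)^[m] (some c)) h1).trans e).trans
    (congrArg some h2.symm)

end PDL

/-! ### Both forms of the time bound -/

theorem mainTheorem1 :
    PDL.mcTeamSize.FPT ∧
    ∃ (C : ℕ) (p : Polynomial ℕ) (M : Turing.TM2ComputableAux PDL.Sym Bool),
      PDL.mcTeamSize.DecidedBy M (fun I : PDL.MCInstance =>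
        C * (2 ^ (2 * I.teamSize) * p.eval I.formula.size)) := by
  refine ⟨⟨fun k => 200 * 2 ^ (2 * k), ?_, (Polynomial.X + 1) ^ 3, PDL.checker,
    PDL.decidedBy_checker fun I => ?_⟩, 200, (Polynomial.X + 1) ^ 3, PDL.checker,
    PDL.decidedBy_checker fun I => ?_⟩
  · have hp : Primrec fun n : ℕ => 2 ^ n := by
      refine (Primrec.nat_rec₁ (f := fun _ y => y * 2) 1
        (Primrec.nat_mul.comp Primrec.snd (Primrec.const 2))).of_eq fun n => ?_
      induction n with
      | zero => rfl
      | succ n ih => rw [pow_succ, ← ih]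
    exact (Primrec.nat_mul.comp (Primrec.const 200)
      (hp.comp (Primrec.nat_mul.comp (Primrec.const 2) Primrec.id))).to_comp
  -- The formula is a prefix of the input, so the sharper bound implies the one in the length of the
  -- whole input.
  · have h : I.formula.size ≤ I.encode.length := by
      simp [PDL.MCInstance.encode, PDL.Formula.size]
    simp only [Polynomial.eval_pow, Polynomial.eval_add, Polynomial.eval_X, Polynomial.eval_one,
      mul_assoc]
    change _ ≤ 200 * (2 ^ (2 * I.teamSize) * (I.encode.length + 1) ^ 3)
    gcongr
  · simp
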